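/- Let $M$ be a closed (compact, boundaryless, Hausdorff) smooth manifold of dimension $n$, let $\Omega$ be its bundle of complex $1$-densities, $C^\infty(M)$ the algebra of smooth complex functions and $\mathcal D'(M)=C^\infty(M;\Omega)'$ the space of distributions; $C^\infty(M)\subset\mathcal D'(M)$ via $f\mapsto(\eta\mapsto\int_M f\eta)$. Let $\Psi^{-\infty}(M)=\Gamma(M\times M;\pi_2^*\Omega)$ be the Fréchet space of smoothing operators, identified with their smooth kernels $k_T(x,y)$, acting by $(Tu)(x)=\langle u(y),k_T(x,y)\rangle$. All spaces of smooth sections carry the $C^\infty$ topology. A net $(x_\varepsilon)_{\varepsilon\in(0,1)}$ in a locally convex space $X$ is moderate (resp. negligible) if $\varepsilon\mapsto x_\varepsilon$ is smooth and for every continuous seminorm $\rho$ one has $\rho(x_\varepsilon)=O(\varepsilon^N)$ as $\varepsilon\to0$ for some (resp. for every) $N\in\mathbb Z$. Let $\mathcal U$ be the set of moderate approximate units: moderate nets $T_\varepsilon$ in $\Psi^{-\infty}(M)$ such that $T_\varepsilon u\to u$ in $\mathcal D'(M)$ for all $u\in\mathcal D'(M)$, and $\rho(T_\varepsilon f-f)=O(\varepsilon^N)$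 for all $f\in C^\infty(M)$, all continuous seminorms $\rho$ on $C^\infty(M)$ and all $N\in\mathbb Z$. Let $E^\infty$ be the algebra, under pointwise operations, of smooth maps $\phi:\Psi^{-\infty}(M)\to C^\infty(M)$ between Fréchet spaces. For a set $\mathcal L\subset\mathcal U$ let $E_{\mathcal L}\subset E^\infty$ (resp. $N_{\mathcal L}$) be the set of $\phi$ such that $\phi(T_\varepsilon)$ is a moderate (resp. negligible) net in $C^\infty(M)$ for every $(T_\varepsilon)\in\mathcal L$; $N_{\mathcal L}$ is an ideal of the algebra $E_{\mathcal L}$, and $\mathcal G_{\mathcal L}(M)=E_{\mathcal L}/N_{\mathcal L}$. For $u\in\mathcal D'(M)$ put $\Theta_u(T)=T(u)$. For a diffeomorphism $\chi$ of $M$ put $\chi_*T=(\chi^{-1})^*\circ T\circ\chi^*$ for $T\in\Psi^{-\infty}(M)$ and $(\chi^*\phi)(T)=\chi^*(\phi(\chi_*T))$ for $\phi\in E^\infty$, where $\langle\chi^*u,\eta\rangle=\langle u,(\chi^{-1})^*\eta\rangle$ for distributions $u$. Then: (1) $\Theta_u\in E_{\mathcal U}$ for every $u\in\mathcal D'(M)$;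 hence $\Theta_u\in E_{\mathcal L}$ for every $\mathcal L\subset\mathcal U$. (2) For every $\mathcal L\subset\mathcal U$ the map $u\mapsto[\Theta_u]$, $\mathcal D'(M)\to\mathcal G_{\mathcal L}(M)$, is linear; it is injective if $\mathcal L\neq\emptyset$; and its restriction to $C^\infty(M)$ is a homomorphism of unital $\mathbb C$-algebras. (3) $u\mapsto\Theta_u$ is an injective linear map $\mathcal D'(M)\to E^\infty$, and it is equivariant under diffeomorphisms: for every diffeomorphism $\chi$ of $M$, $\chi^*$ maps $E^\infty$ to itself and $\chi^*(\Theta_u)=\Theta_{\chi^*u}$ for all $u\in\mathcal D'(M)$. -/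

import Mathlib

open Set Filter Topology MeasureTheory Asymptotics
open scoped Manifold ContDiff

namespace GenFun

section LocalSeminorms

/-- A family of local coordinate representations of the elements of a complex vector space `V`
by complex functions that are smooth on open subsets of a normed space `F`. -/
structure CoordSystem (J F V : Type*) [NormedAddCommGroup F] [NormedSpace ℝ F]
    [AddCommGroup V] [Module ℂ V] where
  dom : J → Set F
  isOpen_dom : ∀ j, IsOpen (dom j)
  rep : J → V →ₗ[ℂ] (F → ℂ)
  contDiffOn_rep : ∀ j v, ContDiffOn ℝ ∞ (rep j v) (dom j)

variable {J F V : Type*} [NormedAddCommGroup F] [NormedSpace ℝ F] [AddCommGroup V] [Module ℂ V]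

theorem continuousOn_iteratedFDeriv {f : F → ℂ} {U : Set F} (hU : IsOpen U)
    (hf : ContDiffOn ℝ ∞ f U) (k : ℕ) : ContinuousOn (iteratedFDeriv ℝ k f) U := by
  have h := hf.continuousOn_iteratedFDerivWithin (m := k) (by exact_mod_cast le_top)
    hU.uniqueDiffOn
  exact h.congr fun z hz => (iteratedFDerivWithin_of_isOpen k hU hz).symm

theorem bddAbove_iteratedFDeriv {f : F → ℂ} {U : Set F} (hU : IsOpen U)
    (hf : ContDiffOn ℝ ∞ f U) (k : ℕ) {K : Set F} (hK : IsCompact K) (hKU : K ⊆ U) :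
    BddAbove (range fun z : K => ‖iteratedFDeriv ℝ k f z‖) := by
  have h := (hK.image_of_continuousOn
    ((continuousOn_iteratedFDeriv hU hf k).mono hKU).norm).bddAbove
  rwa [image_eq_range] at h

theorem contDiffAt_of_open {f : F → ℂ} {U : Set F} (hU : IsOpen U)
    (hf : ContDiffOn ℝ ∞ f U) (k : ℕ) {z : F} (hz : z ∈ U) : ContDiffAt ℝ k f z :=
  (hf.contDiffAt (hU.mem_nhds hz)).of_le (by exact_mod_cast le_top)

namespace CoordSystem

/-- The basic seminorms: `v ↦ sup_{z ∈ K} ‖D^k (rep_j v)(z)‖` with `K` a compact subset of the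
domain of the `j`-th representation. -/
noncomputable def seminorms (C : CoordSystem J F V) :
    SeminormFamily ℂ V (Σ j : J, {K : Set F // IsCompact K ∧ K ⊆ C.dom j} × ℕ) := fun i =>
  Seminorm.of (fun v => ⨆ z : (i.2.1 : Set F), ‖iteratedFDeriv ℝ i.2.2 (C.rep i.1 v) z‖)
    (by
      obtain ⟨j, ⟨K, hK, hKU⟩, k⟩ := i
      intro v w
      dsimp only
      have hb := fun v => bddAbove_iteratedFDeriv (C.isOpen_dom j) (C.contDiffOn_rep j v) k hK hKU
      have h0 := fun v => Real.iSup_nonneg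
        (fun z : K => norm_nonneg (iteratedFDeriv ℝ k (C.rep j v) z))
      refine Real.iSup_le (fun z => ?_) (add_nonneg (h0 v) (h0 w))
      rw [map_add, iteratedFDeriv_add_apply
        (contDiffAt_of_open (C.isOpen_dom j) (C.contDiffOn_rep j v) k (hKU z.2))
        (contDiffAt_of_open (C.isOpen_dom j) (C.contDiffOn_rep j w) k (hKU z.2))]
      exact (norm_add_le _ _).trans (add_le_add (le_ciSup (hb v) z) (le_ciSup (hb w) z)))
    (by
      obtain ⟨j, ⟨K, hK, hKU⟩, k⟩ := i
      intro a v
      dsimp only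
      rw [Real.mul_iSup_of_nonneg (norm_nonneg a)]
      refine iSup_congr fun z => ?_
      rw [map_smul, iteratedFDeriv_const_smul_apply
        (contDiffAt_of_open (C.isOpen_dom j) (C.contDiffOn_rep j v) k (hKU z.2)), norm_smul])

/-- The locally convex topology generated by the basic seminorms. -/
@[reducible] noncomputable def topology (C : CoordSystem J F V) : TopologicalSpace V :=
  C.seminorms.moduleFilterBasis.topology

theorem withSeminorms (C : CoordSystem J F V) :
    @WithSeminorms ℂ V _ _ _ _ C.seminorms C.topology :=
  @WithSeminorms.mk ℂ V _ _ _ _ C.seminorms C.topology rfl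

theorem le_seminorms (C : CoordSystem J F V) (j : J) {K : Set F} (hK : IsCompact K ∧ K ⊆ C.dom j)
    (k : ℕ) (v : V) {z : F} (hz : z ∈ K) :
    ‖iteratedFDeriv ℝ k (C.rep j v) z‖ ≤ C.seminorms ⟨j, ⟨K, hK⟩, k⟩ v :=
  le_ciSup (bddAbove_iteratedFDeriv (C.isOpen_dom j) (C.contDiffOn_rep j v) k hK.1 hK.2) ⟨z, hz⟩

theorem seminorms_le (C : CoordSystem J F V) (j : J) {K : Set F} (hK : IsCompact K ∧ K ⊆ C.dom j)
    (k : ℕ) (v : V) {B : ℝ} (hB : 0 ≤ B) (h : ∀ z ∈ K, ‖iteratedFDeriv ℝ k (C.rep j v) z‖ ≤ B) :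
    C.seminorms ⟨j, ⟨K, hK⟩, k⟩ v ≤ B :=
  Real.iSup_le (fun z => h z z.2) hB

end CoordSystem

end LocalSeminorms

section FrechetSmooth

universe u v

/-- `f` is of class `C^m` on `U` in the sense of calculus in locally convex spaces
(Michal-Bastiani, Hamilton): `f` is continuous on `U`, and for `m ≥ 1` the directional derivatives
`df (x, h) = lim_{t → 0} (f (x + t h) - f x) / t` exist and are of class `C^(m-1)` on `U × E`. -/
def FrechetContDiffOn : ℕ → ∀ {E : Type u} {F : Type v} [AddCommGroup E] [Module ℝ E]
    [TopologicalSpace E] [AddCommGroup F] [Module ℝ F] [TopologicalSpace F],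
    (E → F) → Set E → Prop
  | 0, _, _, _, _, _, _, _, _, f, U => ContinuousOn f U
  | m + 1, E, F, _, _, _, _, _, _, f, U => ContinuousOn f U ∧ ∃ df : E × E → F,
      (∀ x ∈ U, ∀ h : E,
        Tendsto (fun t : ℝ => t⁻¹ • (f (x + t • h) - f x)) (𝓝[≠] 0) (𝓝 (df (x, h)))) ∧
      FrechetContDiffOn m df (U ×ˢ (univ : Set E))

variable {E : Type u} {F : Type v} [AddCommGroup E] [Module ℝ E] [TopologicalSpace E]
  [AddCommGroup F] [Module ℝ F] [TopologicalSpace F]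

/-- Smooth (`C^∞`) maps between locally convex spaces. -/
def FrechetSmoothOn (f : E → F) (U : Set E) : Prop := ∀ m, FrechetContDiffOn m f U

theorem FrechetContDiffOn.continuousOn {m : ℕ} {f : E → F} {U : Set E}
    (hf : FrechetContDiffOn m f U) : ContinuousOn f U := by
  cases m with
  | zero => exact hf
  | succ m => exact hf.1

theorem FrechetContDiffOn.pred {m : ℕ} : ∀ {E : Type u} {F : Type v} [AddCommGroup E] [Module ℝ E]
    [TopologicalSpace E] [AddCommGroup F] [Module ℝ F] [TopologicalSpace F]
    {f : E → F} {U : Set E}, FrechetContDiffOn (m + 1) f U → FrechetContDiffOn m f U := by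
  induction m with
  | zero => intro E F _ _ _ _ _ _ f U hf; exact hf.1
  | succ m ih =>
    intro E F _ _ _ _ _ _ f U hf
    obtain ⟨h0, df, h1, h2⟩ := hf
    exact ⟨h0, df, h1, ih h2⟩

theorem FrechetContDiffOn.comp_linear {m : ℕ} : ∀ {E E' : Type u} {F : Type v} [AddCommGroup E]
    [Module ℝ E] [TopologicalSpace E] [AddCommGroup E'] [Module ℝ E'] [TopologicalSpace E']
    [AddCommGroup F] [Module ℝ F] [TopologicalSpace F] {f : E → F} {U : Set E}
    (A : E' →L[ℝ] E) {U' : Set E'}, MapsTo A U' U →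
    FrechetContDiffOn m f U → FrechetContDiffOn m (fun x => f (A x)) U' := by
  induction m with
  | zero =>
    intro E E' F _ _ _ _ _ _ _ _ _ f U A U' hA hf
    exact ContinuousOn.comp (g := f) hf A.continuous.continuousOn hA
  | succ m ih =>
    intro E E' F _ _ _ _ _ _ _ _ _ f U A U' hA hf
    obtain ⟨h0, df, h1, h2⟩ := hf
    refine ⟨h0.comp A.continuous.continuousOn hA, fun p => df (A p.1, A p.2), ?_, ?_⟩
    · intro x hx h
      simpa using h1 (A x) (hA hx) (A h)
    · have hm : MapsTo (A.prodMap A) (U' ×ˢ univ) (U ×ˢ univ) := fun p hp => ⟨hA hp.1, mem_univ _⟩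
      exact ih (f := df) (A.prodMap A) hm h2

theorem FrechetContDiffOn.const {m : ℕ} : ∀ {E : Type u} {F : Type v} [AddCommGroup E] [Module ℝ E]
    [TopologicalSpace E] [AddCommGroup F] [Module ℝ F] [TopologicalSpace F]
    (b : F) (U : Set E), FrechetContDiffOn m (fun _ : E => b) U := by
  induction m with
  | zero => intro E F _ _ _ _ _ _ b U; exact continuousOn_const
  | succ m ih =>
    intro E F _ _ _ _ _ _ b U
    exact ⟨continuousOn_const, fun _ => 0, fun x _ h => by simpa using tendsto_const_nhds, ih 0 _⟩

theorem FrechetContDiffOn.add {m : ℕ} : ∀ {E : Type u} {F : Type v} [AddCommGroup E] [Module ℝ E]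
    [TopologicalSpace E] [AddCommGroup F] [Module ℝ F] [TopologicalSpace F] [ContinuousAdd F]
    {f g : E → F} {U : Set E}, FrechetContDiffOn m f U → FrechetContDiffOn m g U →
    FrechetContDiffOn m (fun x => f x + g x) U := by
  induction m with
  | zero => intro E F _ _ _ _ _ _ _ f g U hf hg; exact ContinuousOn.add hf hg
  | succ m ih =>
    intro E F _ _ _ _ _ _ _ f g U hf hg
    obtain ⟨h0, df, h1, h2⟩ := hf
    obtain ⟨k0, dg, k1, k2⟩ := hg
    refine ⟨h0.add k0, fun p => df p + dg p, fun x hx h => ?_, ih h2 k2⟩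
    refine ((h1 x hx h).add (k1 x hx h)).congr fun t => ?_
    rw [← smul_add, add_sub_add_comm]

theorem FrechetContDiffOn.mul {m : ℕ} : ∀ {E : Type u} {F : Type v} [AddCommGroup E] [Module ℝ E]
    [TopologicalSpace E] [CommRing F] [Algebra ℝ F] [TopologicalSpace F]
    [IsTopologicalRing F] [ContinuousSMul ℝ F]
    {f g : E → F} {U : Set E}, FrechetContDiffOn m f U → FrechetContDiffOn m g U →
    FrechetContDiffOn m (fun x => f x * g x) U := by
  induction m with
  | zero => intro E F _ _ _ _ _ _ _ _ f g U hf hg; exact ContinuousOn.mul hf hg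
  | succ m ih =>
    intro E F _ _ _ _ _ _ _ _ f g U hf hg
    have hf' := hf.pred
    have hg' := hg.pred
    obtain ⟨h0, df, h1, h2⟩ := hf
    obtain ⟨k0, dg, k1, k2⟩ := hg
    refine ⟨h0.mul k0, fun p => df p * g p.1 + f p.1 * dg p, fun x hx h => ?_, ?_⟩
    · have hg0 : Tendsto (fun t : ℝ => g (x + t • h)) (𝓝[≠] 0) (𝓝 (g x)) := by
        have ht : Tendsto (fun t : ℝ => t) (𝓝[≠] 0) (𝓝 0) := tendsto_id.mono_left inf_le_left
        have := (ht.smul (k1 x hx h)).add_const (g x)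
        rw [zero_smul, zero_add] at this
        refine this.congr' ?_
        filter_upwards [self_mem_nhdsWithin] with t ht
        rw [smul_inv_smul₀ (by simpa using ht)]; abel
      refine (((h1 x hx h).mul hg0).add ((tendsto_const_nhds (x := f x)).mul (k1 x hx h))).congr
        fun t => ?_
      rw [smul_mul_assoc, mul_smul_comm, ← smul_add]; congr 1; ring
    · have hfst : MapsTo (ContinuousLinearMap.fst ℝ E E) (U ×ˢ univ) U := fun p hp => hp.1
      exact (ih h2 (hg'.comp_linear (ContinuousLinearMap.fst ℝ E E) hfst)).add
        (ih (hf'.comp_linear (ContinuousLinearMap.fst ℝ E E) hfst) k2)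

end FrechetSmooth

section Nets

/-- Moderate nets in a locally convex space: smooth maps `(0, 1) → X` such that for every
continuous seminorm `ρ` one has `ρ (x ε) = O(ε ^ N)` as `ε → 0` for some integer `N`.
Only the values on the interval `(0, 1)` matter. -/
def IsModerateNet {X : Type*} [AddCommGroup X] [Module ℂ X] [TopologicalSpace X] (x : ℝ → X) :
    Prop :=
  FrechetSmoothOn x (Ioo 0 1) ∧ ∀ ρ : Seminorm ℂ X, Continuous ρ →
    ∃ N : ℤ, (fun ε => ρ (x ε)) =O[𝓝[>] 0] fun ε : ℝ => ε ^ N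

/-- Negligible nets: smooth maps `(0, 1) → X` such that for every
continuous seminorm `ρ` one has `ρ (x ε) = O(ε ^ N)` as `ε → 0` for all integers `N`. -/
def IsNegligibleNet {X : Type*} [AddCommGroup X] [Module ℂ X] [TopologicalSpace X] (x : ℝ → X) :
    Prop :=
  FrechetSmoothOn x (Ioo 0 1) ∧ ∀ ρ : Seminorm ℂ X, Continuous ρ →
    ∀ N : ℤ, (fun ε => ρ (x ε)) =O[𝓝[>] 0] fun ε : ℝ => ε ^ N

end Nets


/-! ### Functions, densities and distributions on a manifold -/

section Manifold

/-- The model space of `n`-dimensional manifolds. -/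
abbrev Model (n : ℕ) := EuclideanSpace ℝ (Fin n)

variable (n : ℕ) (M : Type*) [TopologicalSpace M] [ChartedSpace (Model n) M]

/-- The smooth charts of `M` (all members of the maximal smooth atlas). -/
abbrev SmoothChart := {c : OpenPartialHomeomorph M (Model n) // c ∈ IsManifold.maximalAtlas (𝓡 n) ∞ M}

/-- The algebra of smooth complex functions on `M`, inside all functions. -/
def smoothSubalgebra : Subalgebra ℂ (M → ℂ) where
  carrier := {f | ContMDiff (𝓡 n) 𝓘(ℝ, ℂ) ∞ f}
  mul_mem' := fun {f g} hf hg => by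
    have h : ContDiff ℝ ∞ fun p : ℂ × ℂ => p.1 * p.2 := contDiff_fst.mul contDiff_snd
    exact h.contMDiff.comp (hf.prodMk_space hg)
  add_mem' := fun hf hg => hf.add hg
  algebraMap_mem' := fun _ => contMDiff_const

/-- `C^∞(M)`: the smooth complex functions on `M`. -/
def SmoothFun : Type _ := smoothSubalgebra n M

noncomputable instance : CommRing (SmoothFun n M) := inferInstanceAs (CommRing (smoothSubalgebra n M))
noncomputable instance : Algebra ℂ (SmoothFun n M) :=
  inferInstanceAs (Algebra ℂ (smoothSubalgebra n M))
instance : CoeFun (SmoothFun n M) (fun _ => M → ℂ) := ⟨fun f => f.1⟩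

variable {n M}

theorem SmoothFun.contMDiff (f : SmoothFun n M) : ContMDiff (𝓡 n) 𝓘(ℝ, ℂ) ∞ f := f.2

theorem contDiffOn_comp_chart_symm {f : M → ℂ} (hf : ContMDiff (𝓡 n) 𝓘(ℝ, ℂ) ∞ f)
    (c : SmoothChart n M) : ContDiffOn ℝ ∞ (fun z => f (c.1.symm z)) c.1.target := by
  rw [← contMDiffOn_iff_contDiffOn]
  exact hf.comp_contMDiffOn (contMDiffOn_symm_of_mem_maximalAtlas c.2)

variable (n M)

/-- The representations `f ∘ c⁻¹` of smooth functions in smooth charts `c`. -/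
def SmoothFun.coords : CoordSystem (SmoothChart n M) (Model n) (SmoothFun n M) where
  dom c := c.1.target
  isOpen_dom c := c.1.open_target
  rep c :=
    { toFun := fun f z => f (c.1.symm z)
      map_add' := fun _ _ => rfl
      map_smul' := fun _ _ => rfl }
  contDiffOn_rep c f := contDiffOn_comp_chart_symm f.contMDiff c

/-- The `C^∞` topology: uniform convergence of all derivatives in charts on compact sets. -/
noncomputable instance : TopologicalSpace (SmoothFun n M) := (SmoothFun.coords n M).topology

variable {n} in
/-- `η : W^n → ℂ` is a `1`-density on the `n`-dimensional vector space `W`. -/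
def IsDensity {W : Type*} [AddCommGroup W] [Module ℝ W] (η : (Fin n → W) → ℂ) : Prop :=
  ∀ (A : W →ₗ[ℝ] W) (v : Fin n → W), η (fun i => A (v i)) = (|LinearMap.det A| : ℝ) * η v

/-- Functions that assign a complex number to a point `y ∈ M` and an `n`-tuple in `T_y M`. -/
abbrev PreDensity := ∀ y : M, (Fin n → TangentSpace (𝓡 n) y) → ℂ

variable {n M}

/-- The coefficient of `η` in the chart `c`: its value on the coordinate frame of `c`. -/
noncomputable def coeff (c : OpenPartialHomeomorph M (Model n)) (η : PreDensity n M) (z : Model n) : ℂ :=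
  η (c.symm z) (fun i => mfderiv (𝓡 n) (𝓡 n) c.symm z (EuclideanSpace.single i (1 : ℝ)))

variable (n M)

/-- The smooth sections of the density bundle, inside all pre-densities. -/
def densitySubmodule : Submodule ℂ (PreDensity n M) where
  carrier := {η | (∀ y, IsDensity (η y)) ∧
    ∀ c : SmoothChart n M, ContDiffOn ℝ ∞ (coeff c.1 η) c.1.target}
  add_mem' := fun {a b} ha hb => ⟨fun y A v => by
      simp only [Pi.add_apply, ha.1 y A v, hb.1 y A v, mul_add],
    fun c => (ha.2 c).add (hb.2 c)⟩
  zero_mem' := ⟨fun y A v => by simp, fun c => contDiffOn_const (c := (0 : ℂ))⟩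
  smul_mem' := fun a η h => ⟨fun y A v => by
      simp only [Pi.smul_apply, h.1 y A v, smul_eq_mul, mul_left_comm],
    fun c => (h.2 c).const_smul a⟩

/-- `C^∞(M; Ω)`: the smooth complex `1`-densities on `M`. -/
def Density : Type _ := densitySubmodule n M

noncomputable instance : AddCommGroup (Density n M) :=
  inferInstanceAs (AddCommGroup (densitySubmodule n M))
noncomputable instance : Module ℂ (Density n M) := inferInstanceAs (Module ℂ (densitySubmodule n M))
instance : CoeFun (Density n M) (fun _ => PreDensity n M) := ⟨fun η => η.1⟩

/-- The coefficients of smooth densities in smooth charts. -/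
noncomputable def Density.coords : CoordSystem (SmoothChart n M) (Model n) (Density n M) where
  dom c := c.1.target
  isOpen_dom c := c.1.open_target
  rep c :=
    { toFun := fun η => coeff c.1 η
      map_add' := fun _ _ => rfl
      map_smul' := fun _ _ => rfl }
  contDiffOn_rep c η := η.2.2 c

/-- The `C^∞` topology: uniform convergence of all derivatives in charts on compact sets. -/
noncomputable instance : TopologicalSpace (Density n M) := (Density.coords n M).topology

variable {n M} in
/-- The product `f η` of a smooth function and a smooth density. -/
def SmoothFun.mulDensity (f : SmoothFun n M) (η : Density n M) : Density n M :=
  ⟨fun y v => f y * η y v, fun y A v => by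
      simp only [η.2.1 y A v, mul_left_comm],
    fun c => ((SmoothFun.coords n M).contDiffOn_rep c f).mul (η.2.2 c)⟩

/-- `D'(M)`: the distributions on `M`, i.e. the continuous linear functionals on `C^∞(M; Ω)`. -/
abbrev DistributionOn := Density n M →L[ℂ] ℂ

/-- The smooth sections of `π₂^* Ω` over `M × M`, inside all functions that assign to `x ∈ M` a
pre-density. -/
def kernelSubmodule : Submodule ℂ (M → PreDensity n M) where
  carrier := {k | (∀ x y, IsDensity (k x y)) ∧ ∀ c c' : SmoothChart n M,
    ContDiffOn ℝ ∞ (fun p : Model n × Model n => coeff c'.1 (k (c.1.symm p.1)) p.2)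
      (c.1.target ×ˢ c'.1.target)}
  add_mem' := fun {a b} ha hb => ⟨fun x y A v => by
      simp only [Pi.add_apply, ha.1 x y A v, hb.1 x y A v, mul_add],
    fun c c' => (ha.2 c c').add (hb.2 c c')⟩
  zero_mem' := ⟨fun x y A v => by simp, fun c c' => contDiffOn_const (c := (0 : ℂ))⟩
  smul_mem' := fun a k h => ⟨fun x y A v => by
      simp only [Pi.smul_apply, h.1 x y A v, smul_eq_mul, mul_left_comm],
    fun c c' => (h.2 c c').const_smul a⟩

/-- `Ψ^{-∞}(M) = Γ(M × M; π₂^* Ω)`: the smoothing operators on `M`, identified with their smooth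
kernels `k(x, y)`, which are densities in `y`. -/
def SmoothingOp : Type _ := kernelSubmodule n M

noncomputable instance : AddCommGroup (SmoothingOp n M) :=
  inferInstanceAs (AddCommGroup (kernelSubmodule n M))
noncomputable instance : Module ℂ (SmoothingOp n M) :=
  inferInstanceAs (Module ℂ (kernelSubmodule n M))

/-- The coefficients of smooth kernels in products of smooth charts. -/
noncomputable def SmoothingOp.coords :
    CoordSystem (SmoothChart n M × SmoothChart n M) (Model n × Model n) (SmoothingOp n M) where
  dom c := c.1.1.target ×ˢ c.2.1.target
  isOpen_dom c := c.1.1.open_target.prod c.2.1.open_target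
  rep c :=
    { toFun := fun T p => coeff c.2.1 (T.1 (c.1.1.symm p.1)) p.2
      map_add' := fun _ _ => rfl
      map_smul' := fun _ _ => rfl }
  contDiffOn_rep c T := T.2.2 c.1 c.2

/-- The `C^∞` topology of kernels: uniform convergence of all derivatives in products of charts on
compact sets. -/
noncomputable instance : TopologicalSpace (SmoothingOp n M) := (SmoothingOp.coords n M).topology

end Manifold

/-! ### Smooth families and continuous functionals -/

section SmoothFamilies

/-- A jointly smooth function `h (z, w)` gives a smooth map into `C(K, A)`, `K` compact. -/
theorem contDiffOn_toContinuousMap {G W : Type} [NormedAddCommGroup G] [NormedSpace ℝ G]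
    [NormedAddCommGroup W] [NormedSpace ℝ W] {U : Set G} {D K : Set W} (hU : IsOpen U)
    (hD : IsOpen D) (hKD : K ⊆ D) [CompactSpace K] (m : ℕ) :
    ∀ {A : Type} [NormedAddCommGroup A] [NormedSpace ℝ A] {h : G × W → A}
      (_ : ContDiffOn ℝ ∞ h (U ×ˢ D)) (H : G → C(K, A)),
      (∀ z ∈ U, ∀ w : K, H z w = h (z, w)) → ContDiffOn ℝ m H U := by
  have hcont : ∀ {A : Type} [NormedAddCommGroup A] [NormedSpace ℝ A] {h : G × W → A}
      (_ : ContDiffOn ℝ ∞ h (U ×ˢ D)) (H : G → C(K, A)),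
      (∀ z ∈ U, ∀ w : K, H z w = h (z, w)) → ContinuousOn H U := by
    intro A _ _ h hh H hH
    rw [continuousOn_iff_continuous_domRestrict]
    let g : C(U × K, A) := ⟨fun p => h (p.1, p.2), by
      refine hh.continuousOn.comp_continuous (by fun_prop) fun p => ⟨p.1.2, hKD p.2.2⟩⟩
    have : U.domRestrict H = g.curry := by
      funext z; ext w; exact hH z z.2 w
    rw [this]; exact g.curry.continuous
  induction m with
  | zero =>
    intro A _ _ h hh H hH
    exact contDiffOn_zero.2 (hcont hh H hH)
  | succ m ih =>
    intro A _ _ h hh H hH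
    have hUD : IsOpen (U ×ˢ D) := hU.prod hD
    let h1 : G × W → (G →L[ℝ] A) := fun p => (fderiv ℝ h p).comp (ContinuousLinearMap.inl ℝ G W)
    have hh1 : ContDiffOn ℝ ∞ h1 (U ×ˢ D) :=
      (hh.fderiv_of_isOpen hUD (m := ∞) (by simp)).clm_comp contDiffOn_const
    classical
    let H1 : G → C(K, G →L[ℝ] A) := fun z => if hz : z ∈ U then
      ⟨fun w => h1 (z, w), hh1.continuousOn.comp_continuous (by fun_prop)
        fun w => ⟨hz, hKD w.2⟩⟩ else 0
    have hH1 : ∀ z ∈ U, ∀ w : K, H1 z w = h1 (z, w) := fun z hz w => by simp [H1, hz]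
    let Φ : C(K, G →L[ℝ] A) →L[ℝ] (G →L[ℝ] C(K, A)) :=
      LinearMap.mkContinuous₂
        (LinearMap.mk₂ ℝ (fun (φ : C(K, G →L[ℝ] A)) (v : G) =>
          (⟨fun w => φ w v, by fun_prop⟩ : C(K, A)))
          (fun _ _ _ => by ext; simp) (fun _ _ _ => by ext; simp)
          (fun _ _ _ => by ext; simp) (fun _ _ _ => by ext; simp)) 1
        (fun φ v => by
          rw [one_mul, ContinuousMap.norm_le _ (by positivity)]
          intro w
          exact ((φ w).le_opNorm v).trans (by gcongr; exact φ.norm_coe_le_norm w))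
    have hΦ : ∀ φ v w, Φ φ v w = φ w v := fun _ _ _ => rfl
    have hc1 := hcont hh1 H1 hH1
    have hd : ∀ z ∈ U, HasFDerivAt H (Φ (H1 z)) z := by
      intro z hz
      rw [hasFDerivAt_iff_isLittleO, Asymptotics.isLittleO_iff]
      intro e he
      obtain ⟨r, hr, hball⟩ := Metric.mem_nhds_iff.1
        (Filter.inter_mem (hU.mem_nhds hz)
          ((hc1.continuousAt (hU.mem_nhds hz)) (Metric.closedBall_mem_nhds _ he)))
      filter_upwards [Metric.ball_mem_nhds z hr] with z' hz'
      rw [ContinuousMap.norm_le _ (by positivity)]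
      intro w
      have hzr : z ∈ Metric.ball z r := Metric.mem_ball_self hr
      have key := (convex_ball z r).norm_image_sub_le_of_norm_hasFDerivWithin_le'
        (f := fun y => h (y, (w : W))) (f' := fun y => h1 (y, w)) (φ := h1 (z, w)) (C := e)
        (fun y hy => by
          have hyU := (hball hy).1
          have hd := ((hh.differentiableOn (by simp)).differentiableAt
            (hUD.mem_nhds (⟨hyU, hKD w.2⟩ : (y, (w : W)) ∈ U ×ˢ D))).hasFDerivAt
          exact (hd.comp y (hasFDerivAt_prodMk_left y (w : W))).hasFDerivWithinAt)
        (fun y hy => by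
          have hyU := (hball hy).1
          have h2 := (hball hy).2
          rw [mem_preimage, Metric.mem_closedBall, dist_eq_norm] at h2
          have h3 := (H1 y - H1 z).norm_coe_le_norm w
          rw [ContinuousMap.sub_apply, hH1 y hyU, hH1 z hz] at h3
          exact h3.trans h2) hzr hz'
      simpa [hΦ, hH z hz, hH z' (hball hz').1, hH1 z hz] using key
    rw [Nat.cast_succ, contDiffOn_succ_iff_fderiv_of_isOpen hU]
    refine ⟨fun z hz => (hd z hz).differentiableAt.differentiableWithinAt, by simp, ?_⟩
    have hΦd : ContDiff ℝ m (fun φ => Φ φ) :=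
      @ContinuousLinearMap.contDiff ℝ C(K, G →L[ℝ] A) (G →L[ℝ] C(K, A)) _ _ _ _ _ m Φ
    have h2 : ContDiffOn ℝ m (fun z => Φ (H1 z)) U := hΦd.comp_contDiffOn (ih hh1 H1 hH1)
    exact h2.congr fun z hz => (hd z hz).fderiv

theorem contDiffOn_partial_iteratedFDeriv {G W : Type} [NormedAddCommGroup G] [NormedSpace ℝ G]
    [NormedAddCommGroup W] [NormedSpace ℝ W] {U : Set G} {D : Set W} (hU : IsOpen U)
    (hD : IsOpen D) {g : G → W → ℂ} (hg : ContDiffOn ℝ ∞ (fun p : G × W => g p.1 p.2) (U ×ˢ D))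
    (k : ℕ) :
    ContDiffOn ℝ ∞ (fun p : G × W => iteratedFDeriv ℝ k (g p.1) p.2) (U ×ˢ D) := by
  have hUD : IsOpen (U ×ˢ D) := hU.prod hD
  induction k with
  | zero =>
    have : (fun p : G × W => iteratedFDeriv ℝ 0 (g p.1) p.2) =
        (continuousMultilinearCurryFin0 ℝ W ℂ).symm ∘ fun p : G × W => g p.1 p.2 := by
      funext p; rw [iteratedFDeriv_zero_eq_comp]; rfl
    rw [this]
    exact (LinearIsometryEquiv.contDiff _).comp_contDiffOn hg
  | succ k ih =>
    have : (fun p : G × W => iteratedFDeriv ℝ (k + 1) (g p.1) p.2) =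
        (continuousMultilinearCurryLeftEquiv ℝ (fun _ : Fin (k + 1) => W) ℂ).symm ∘
          fun p : G × W => fderiv ℝ (iteratedFDeriv ℝ k (g p.1)) p.2 := by
      funext p; rw [iteratedFDeriv_succ_eq_comp_left]; rfl
    rw [this]
    refine ContDiff.comp_contDiffOn (@LinearIsometryEquiv.contDiff ℝ (W →L[ℝ] W [×k]→L[ℝ] ℂ)
      (W [×(k + 1)]→L[ℝ] ℂ) _ _ _ _ _ ∞ _) fun p hp => ?_
    have h1 : ContDiffAt ℝ ∞ (fun p : G × W => iteratedFDeriv ℝ k (g p.1) p.2) (p.1, p.2) :=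
      ih.contDiffAt (hUD.mem_nhds hp)
    have h2 : ContDiff ℝ ∞ (fun q : (G × W) × W => ((q.1.1, q.2) : G × W)) := by fun_prop
    have h3 : ContDiffAt ℝ ∞ (Function.uncurry fun (q : G × W) (w : W) =>
        iteratedFDeriv ℝ k (g q.1) w) (p, p.2) :=
      ContDiffAt.comp (g := fun p : G × W => iteratedFDeriv ℝ k (g p.1) p.2)
        ((p, p.2) : (G × W) × W) h1 h2.contDiffAt
    have h4 : ContDiffAt ℝ ∞ (fun q : G × W => q.2) p := contDiff_snd.contDiffAt
    exact (ContDiffAt.fderiv h3 h4 (by simp)).contDiffWithinAt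

theorem exists_dual_factorization {V X : Type*} [AddCommGroup V] [Module ℂ V]
    [NormedAddCommGroup X] [NormedSpace ℂ X] (u : V →ₗ[ℂ] ℂ) (L : V →ₗ[ℂ] X) (B : ℝ)
    (hBL : ∀ v, ‖u v‖ ≤ B * ‖L v‖) : ∃ u₂ : X →L[ℂ] ℂ, ∀ v, u v = u₂ (L v) := by
  have hker : LinearMap.ker L ≤ LinearMap.ker u := fun v hv => by
    have h1 := hBL v
    have h2 : L v = 0 := hv
    simpa [h2] using h1
  let u₀ : LinearMap.range L →ₗ[ℂ] ℂ :=
    ((LinearMap.ker L).liftQ u hker).comp L.quotKerEquivRange.symm.toLinearMap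
  have hu₀ : ∀ v, u₀ ⟨L v, v, rfl⟩ = u v := fun v => by
    have : L.quotKerEquivRange.symm ⟨L v, v, rfl⟩ = (LinearMap.ker L).mkQ v := by
      rw [LinearEquiv.symm_apply_eq]; rfl
    simp only [u₀, LinearMap.comp_apply, LinearEquiv.coe_coe, this]
    exact Submodule.liftQ_apply _ _ _
  let u₁ : LinearMap.range L →L[ℂ] ℂ := u₀.mkContinuous B (by
    rintro ⟨_, v, rfl⟩
    rw [hu₀]
    exact hBL v)
  obtain ⟨u₂, hu₂, -⟩ := exists_extension_norm_eq (LinearMap.range L) u₁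
  exact ⟨u₂, fun v => by rw [← hu₀ v]; exact (hu₂ ⟨L v, v, rfl⟩).symm⟩

/-- A continuous functional applied to a smooth family of vectors is a smooth function. -/
theorem CoordSystem.contDiffOn_apply {J V : Type*} {W G : Type}
    [NormedAddCommGroup W] [NormedSpace ℝ W] [NormedAddCommGroup G] [NormedSpace ℝ G]
    [AddCommGroup V] [Module ℂ V] (C : CoordSystem J W V) (u : V →ₗ[ℂ] ℂ)
    (hu : @Continuous V ℂ C.topology _ u) {U : Set G} (hU : IsOpen U) (F : G → V)
    (hF : ∀ j, ContDiffOn ℝ ∞ (fun p : G × W => C.rep j (F p.1) p.2) (U ×ˢ C.dom j)) :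
    ContDiffOn ℝ ∞ (fun z => u (F z)) U := by
  let _ := C.topology
  obtain ⟨s, B, -, hB⟩ := Seminorm.bound_of_continuous C.withSeminorms
    ((normSeminorm ℂ ℂ).comp u) (continuous_norm.comp hu)
  have hB' : ∀ v, ‖u v‖ ≤ B * (s.sup C.seminorms) v := fun v => hB v
  have : ∀ i : s, CompactSpace (i.1.2.1 : Set W) :=
    fun i => isCompact_iff_compactSpace.1 i.1.2.1.2.1
  have hc : ∀ (v : V) (i : s), Continuous fun z : (i.1.2.1 : Set W) =>
      iteratedFDeriv ℝ i.1.2.2 (C.rep i.1.1 v) z := fun v i =>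
    (continuousOn_iteratedFDeriv (C.isOpen_dom _) (C.contDiffOn_rep i.1.1 v) _).comp_continuous
      continuous_subtype_val fun z => i.1.2.1.2.2 z.2
  have hat : ∀ (v : V) (i : s) (z : (i.1.2.1 : Set W)),
      ContDiffAt ℝ i.1.2.2 (C.rep i.1.1 v) z := fun v i z =>
    contDiffAt_of_open (C.isOpen_dom _) (C.contDiffOn_rep i.1.1 v) _ (i.1.2.1.2.2 z.2)
  let L : V →ₗ[ℂ] (∀ i : s, C((i.1.2.1 : Set W), W [×i.1.2.2]→L[ℝ] ℂ)) :=
    { toFun := fun v i => ⟨fun z => iteratedFDeriv ℝ i.1.2.2 (C.rep i.1.1 v) z, hc v i⟩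
      map_add' := fun v w => by
        funext i; ext1 z
        simp only [map_add, ContinuousMap.coe_mk, Pi.add_apply, ContinuousMap.add_apply]
        exact iteratedFDeriv_add_apply (hat v i z) (hat w i z)
      map_smul' := fun a v => by
        funext i; ext1 z
        simp only [map_smul, ContinuousMap.coe_mk, Pi.smul_apply, ContinuousMap.smul_apply,
          RingHom.id_apply]
        exact iteratedFDeriv_const_smul_apply (hat v i z) }
  have hL : ∀ v, (s.sup C.seminorms) v ≤ ‖L v‖ := fun v => by
    refine Seminorm.finset_sup_apply_le (norm_nonneg _) fun i hi => ?_
    refine C.seminorms_le i.1 i.2.1.2 i.2.2 v (norm_nonneg _) fun z hz => ?_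
    exact ((L v ⟨i, hi⟩).norm_coe_le_norm ⟨z, hz⟩).trans (norm_le_pi_norm (L v) ⟨i, hi⟩)
  have hBL : ∀ v, ‖u v‖ ≤ (B : ℝ) * ‖L v‖ := fun v => (hB' v).trans <|
    mul_le_mul_of_nonneg_left (hL v) B.2
  obtain ⟨u₂, hfin⟩ := @exists_dual_factorization V
    (∀ i : s, C((i.1.2.1 : Set W), W [×i.1.2.2]→L[ℝ] ℂ)) _ _ _ _ u L B hBL
  simp_rw [hfin]
  have hu₂ : ContDiff ℝ ∞ (fun x => u₂ x) :=
    @ContinuousLinearMap.contDiff ℝ (∀ i : s, C((i.1.2.1 : Set W), W [×i.1.2.2]→L[ℝ] ℂ)) ℂ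
      _ _ _ _ _ ∞ (u₂.restrictScalars ℝ)
  refine hu₂.comp_contDiffOn (f := fun z => L (F z)) ?_
  rw [contDiffOn_pi]
  intro i
  rw [contDiffOn_infty]
  intro m
  refine contDiffOn_toContinuousMap hU (C.isOpen_dom i.1.1) i.1.2.1.2.2 m
    (contDiffOn_partial_iteratedFDeriv (g := fun z => C.rep i.1.1 (F z)) hU (C.isOpen_dom i.1.1)
      (hF i.1.1) i.1.2.2)
    (fun z => L (F z) i) fun z _ w => rfl

end SmoothFamilies

section SmoothFunTopology

variable {n : ℕ} {M : Type*} [TopologicalSpace M] [ChartedSpace (Model n) M]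

instance : IsTopologicalAddGroup (SmoothFun n M) :=
  (SmoothFun.coords n M).withSeminorms.topologicalAddGroup

instance : ContinuousSMul ℂ (SmoothFun n M) :=
  (SmoothFun.coords n M).withSeminorms.continuousSMul

instance : ContinuousSMul ℝ (SmoothFun n M) where
  continuous_smul := by
    have h : Continuous fun p : ℝ × SmoothFun n M => (p.1 : ℂ) • p.2 := by fun_prop
    exact h

theorem SmoothFun.exists_basic_seminorm_mul_le
    (i : Σ j : SmoothChart n M, {K : Set (Model n) // IsCompact K ∧ K ⊆
      (SmoothFun.coords n M).dom j} × ℕ) :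
    ∃ q : Seminorm ℂ (SmoothFun n M), Continuous q ∧
      ∀ f g, (SmoothFun.coords n M).seminorms i (f * g) ≤ q f * q g := by
  obtain ⟨c, ⟨K, hK⟩, k⟩ := i
  set C := SmoothFun.coords n M with hC
  let S : Seminorm ℂ (SmoothFun n M) :=
    (Finset.range (k + 1)).sup fun l => C.seminorms ⟨c, ⟨K, hK⟩, l⟩
  let q : Seminorm ℂ (SmoothFun n M) := (2 ^ k : NNReal) • S
  have hsup : Continuous S := by
    refine Finset.sup_induction (p := fun r : Seminorm ℂ (SmoothFun n M) => Continuous r) ?_ ?_ ?_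
    · exact continuous_const
    · intro a ha b hb; exact Continuous.sup ha hb
    · intro l _; exact C.withSeminorms.continuous_seminorm ⟨c, ⟨K, hK⟩, l⟩
  have hle : ∀ l ∈ Finset.range (k + 1), ∀ f z, z ∈ K →
      ‖iteratedFDeriv ℝ l (C.rep c f) z‖ ≤ S f := fun l hl f z hz =>
    (C.le_seminorms c hK l f hz).trans
      (Seminorm.le_def.1 (Finset.le_sup (f := fun l => C.seminorms ⟨c, ⟨K, hK⟩, l⟩) hl) f)
  have hq : ∀ f, q f = 2 ^ k * S f := fun f => rfl
  refine ⟨q, continuous_const.mul hsup, fun f g => ?_⟩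
  refine C.seminorms_le c hK k (f * g) (mul_nonneg (apply_nonneg q f) (apply_nonneg q g)) ?_
  intro z hz
  have hzU := hK.2 hz
  have hopen := C.isOpen_dom c
  have h1 := norm_iteratedFDerivWithin_mul_le (C.contDiffOn_rep c f) (C.contDiffOn_rep c g)
    hopen.uniqueDiffOn hzU (n := k) (by exact_mod_cast le_top)
  simp only [iteratedFDerivWithin_of_isOpen _ hopen hzU] at h1
  refine h1.trans ?_
  calc _ ≤ ∑ l ∈ Finset.range (k + 1), (k.choose l : ℝ) * S f * S g := by
        refine Finset.sum_le_sum fun l hl => ?_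
        have hl' : k - l ∈ Finset.range (k + 1) := by simp
        have := hle l hl f z hz
        have := hle (k - l) hl' g z hz
        have := apply_nonneg S f
        gcongr
    _ = 2 ^ k * (S f * S g) := by
        simp_rw [mul_assoc]
        rw [← Finset.sum_mul]
        norm_cast
        rw [Nat.sum_range_choose]
    _ ≤ q f * q g := by
        rw [hq, hq]
        have h2 : (1 : ℝ) ≤ 2 ^ k := one_le_pow₀ (by norm_num)
        have h3 := mul_nonneg (apply_nonneg S f) (apply_nonneg S g)
        have h4 := mul_nonneg (zero_le_one.trans h2) h3
        nlinarith [mul_le_mul_of_nonneg_right h2 h4]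

/-- Multiplication of smooth functions is controlled by continuous seminorms. -/
theorem SmoothFun.exists_seminorm_mul_le (ρ : Seminorm ℂ (SmoothFun n M)) (hρ : Continuous ρ) :
    ∃ q : Seminorm ℂ (SmoothFun n M), Continuous q ∧ ∀ f g, ρ (f * g) ≤ q f * q g := by
  set C := SmoothFun.coords n M with hC
  obtain ⟨s, B, -, hB⟩ := Seminorm.bound_of_continuous C.withSeminorms ρ hρ
  have hsup : ∃ q : Seminorm ℂ (SmoothFun n M), Continuous q ∧
      ∀ f g, (s.sup C.seminorms) (f * g) ≤ q f * q g := by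
    refine Finset.sup_induction (p := fun r : Seminorm ℂ (SmoothFun n M) =>
      ∃ q : Seminorm ℂ (SmoothFun n M), Continuous q ∧ ∀ f g, r (f * g) ≤ q f * q g) ?_ ?_ ?_
    · exact ⟨0, continuous_const, fun f g => by simp⟩
    · rintro a ⟨p, hp, hap⟩ b ⟨q, hq, hbq⟩
      refine ⟨p ⊔ q, Continuous.sup hp hq, fun f g => ?_⟩
      rw [Seminorm.sup_apply]
      have h1 : ∀ f, p f ≤ (p ⊔ q) f := fun f => le_sup_left
      have h2 : ∀ f, q f ≤ (p ⊔ q) f := fun f => le_sup_right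
      exact max_le
        ((hap f g).trans (mul_le_mul (h1 f) (h1 g) (apply_nonneg _ _) (apply_nonneg _ _)))
        ((hbq f g).trans (mul_le_mul (h2 f) (h2 g) (apply_nonneg _ _) (apply_nonneg _ _)))
    · intro i _; exact SmoothFun.exists_basic_seminorm_mul_le i
  obtain ⟨q, hq, hle⟩ := hsup
  refine ⟨(1 + B) • q, continuous_const.mul hq, fun f g => ?_⟩
  have h1 : ρ (f * g) ≤ B * (s.sup C.seminorms) (f * g) := hB (f * g)
  have h2 : ∀ f, ((1 + B) • q) f = (1 + (B : ℝ)) * q f := fun f => rfl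
  rw [h2, h2]
  have h3 := mul_nonneg (apply_nonneg q f) (apply_nonneg q g)
  have h4 : (B : ℝ) * (s.sup C.seminorms) (f * g) ≤ B * (q f * q g) :=
    mul_le_mul_of_nonneg_left (hle f g) B.2
  have h5 : (0 : ℝ) ≤ B := B.2
  nlinarith [mul_nonneg h5 h3, mul_nonneg h5 (mul_nonneg h5 h3)]

instance : IsTopologicalRing (SmoothFun n M) := by
  have hs := (SmoothFun.coords n M).withSeminorms
  have h0 : ∀ q : Seminorm ℂ (SmoothFun n M), Continuous q → Tendsto q (𝓝 0) (𝓝 0) :=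
    fun q hq => by simpa using hq.tendsto 0
  refine IsTopologicalRing.of_addGroup_of_nhds_zero ?_ (fun f => ?_) (fun f => ?_)
  all_goals
    rw [hs.tendsto_nhds]
    intro i e he
    obtain ⟨q, hq, hle⟩ := SmoothFun.exists_basic_seminorm_mul_le i
  · have h1 : Tendsto (fun p : SmoothFun n M × SmoothFun n M => q p.1 * q p.2)
        (𝓝 0 ×ˢ 𝓝 0) (𝓝 0) := by
      simpa using ((h0 q hq).comp tendsto_fst).mul ((h0 q hq).comp tendsto_snd)
    filter_upwards [h1.eventually_lt_const he] with p hp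
    rw [sub_zero]
    exact (hle p.1 p.2).trans_lt hp
  · have h1 : Tendsto (fun g => q f * q g) (𝓝 0) (𝓝 0) := by
      simpa using (h0 q hq).const_mul (q f)
    filter_upwards [h1.eventually_lt_const he] with g hg
    rw [sub_zero]
    exact (hle f g).trans_lt hg
  · have h1 : Tendsto (fun g => q g * q f) (𝓝 0) (𝓝 0) := by
      simpa using (h0 q hq).mul_const (q f)
    filter_upwards [h1.eventually_lt_const he] with g hg
    rw [sub_zero]
    exact (hle g f).trans_lt hg

end SmoothFunTopology

section Operators

variable {n : ℕ} {M : Type*} [TopologicalSpace M] [ChartedSpace (Model n) M]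
  [IsManifold (𝓡 n) ∞ M]

/-- The preferred chart at `x`, as a member of the maximal atlas. -/
def chartOf (x : M) : SmoothChart n M :=
  ⟨chartAt (Model n) x, IsManifold.chart_mem_maximalAtlas x⟩

/-- A function is smooth if it is smooth in all smooth charts. -/
theorem contMDiff_of_charts {f : M → ℂ}
    (hf : ∀ c : SmoothChart n M, ContDiffOn ℝ ∞ (fun z => f (c.1.symm z)) c.1.target) :
    ContMDiff (𝓡 n) 𝓘(ℝ, ℂ) ∞ f := by
  intro x
  have hx : x ∈ (chartOf (n := n) x).1.source := mem_chart_source _ x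
  have h1 : ContMDiffOn (𝓡 n) 𝓘(ℝ, ℂ) ∞
      ((fun z => f ((chartOf (n := n) x).1.symm z)) ∘ (chartOf (n := n) x).1)
      (chartOf (n := n) x).1.source :=
    (contMDiffOn_iff_contDiffOn.2 (hf (chartOf x))).comp
      (contMDiffOn_of_mem_maximalAtlas (chartOf x).2)
      (chartOf (n := n) x).1.mapsTo
  have h2 : ContMDiffOn (𝓡 n) 𝓘(ℝ, ℂ) ∞ f (chartOf (n := n) x).1.source :=
    h1.congr fun y hy => by
      simp only [Function.comp_apply, (chartOf (n := n) x).1.left_inv hy]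
  exact h2.contMDiffAt ((chartOf (n := n) x).1.open_source.mem_nhds hx)

/-- The density `k_T(x, ·)`. -/
def SmoothingOp.row (T : SmoothingOp n M) (x : M) : Density n M :=
  ⟨T.1 x, T.2.1 x, fun c' => by
    have hx : x ∈ (chartOf (n := n) x).1.source := mem_chart_source _ x
    have h := (T.2.2 (chartOf x) c').comp
      (f := fun w : Model n => ((chartOf (n := n) x).1 x, w)) (s := c'.1.target)
      (by fun_prop) (fun w hw => ⟨(chartOf (n := n) x).1.map_source hx, hw⟩)
    refine h.congr fun w _ => ?_
    simp only [Function.comp_apply, (chartOf (n := n) x).1.left_inv hx]⟩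

/-- The action of a smoothing operator on distributions, `(T u)(x) = ⟨u(y), k_T(x, y)⟩`. -/
noncomputable def SmoothingOp.apply (T : SmoothingOp n M) (u : DistributionOn n M) : SmoothFun n M :=
  ⟨fun x => u (T.row x), contMDiff_of_charts fun c =>
    (Density.coords n M).contDiffOn_apply u.toLinearMap u.continuous c.1.open_target
      (fun z => T.row (c.1.symm z)) fun c' => T.2.2 c c'⟩

/-- The evaluation map `Θ_u(T) = T(u)`, as a linear function of `u`. -/
noncomputable def evalMap (n : ℕ) (M : Type*) [TopologicalSpace M] [ChartedSpace (Model n) M]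
    [IsManifold (𝓡 n) ∞ M] : DistributionOn n M →ₗ[ℂ] (SmoothingOp n M → SmoothFun n M) where
  toFun u T := T.apply u
  map_add' _ _ := rfl
  map_smul' _ _ := rfl

end Operators

section Integration

variable (n : ℕ) (M : Type*) [TopologicalSpace M] [ChartedSpace (Model n) M]
  [IsManifold (𝓡 n) ∞ M] [CompactSpace M] [T2Space M]

theorem exists_chart_partition : ∃ φ : SmoothPartitionOfUnity M (𝓡 n) M univ,
    φ.IsSubordinate fun x => (chartAt (Model n) x).source :=
  SmoothPartitionOfUnity.exists_isSubordinate (𝓡 n) isClosed_univ _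
    (fun x => (chartAt (Model n) x).open_source) fun x _ => mem_iUnion.2 ⟨x, mem_chart_source _ x⟩

/-- A smooth partition of unity on `M` subordinate to the cover by the charts `chartAt x`. -/
noncomputable def chartPartition : SmoothPartitionOfUnity M (𝓡 n) M univ :=
  (exists_chart_partition n M).choose

variable {n M}

/-- The integral `∫_M η` of a smooth density: with a partition of unity `φ_i` subordinate to the
domains of charts `c_i` it is `∑_i ∫ φ_i (c_i⁻¹ z) η_{c_i}(z) dz` (Lebesgue measure). By the change
of variables formula it does not depend on the partition of unity or on the charts. -/
noncomputable def Density.integral (η : Density n M) : ℂ :=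
  ∑ᶠ i : M, ∫ z in (chartAt (Model n) i).target,
    (chartPartition n M i ((chartAt (Model n) i).symm z) : ℂ) * coeff (chartAt (Model n) i) η z

theorem finite_partition : {i : M | ∃ x, chartPartition n M i x ≠ 0}.Finite :=
  (chartPartition n M).locallyFinite.finite_nonempty_of_compact

/-- The `i`-th term of the integral of `f η` is a continuous linear functional of `η`. -/
theorem integral_term (f : SmoothFun n M) (i : M) : ∃ ℓ : Density n M →L[ℂ] ℂ, ∀ η, ℓ η =
    ∫ z in (chartAt (Model n) i).target,
      (chartPartition n M i ((chartAt (Model n) i).symm z) : ℂ) *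
        coeff (chartAt (Model n) i) (f.mulDensity η) z := by
  set φ := chartPartition n M i with hφ
  set c := chartAt (Model n) i with hc
  have hsub : tsupport φ ⊆ c.source := (exists_chart_partition n M).choose_spec i
  have hcφ : IsCompact (tsupport φ) := (isClosed_tsupport _).isCompact
  set K := c '' tsupport φ with hK
  have hKc : IsCompact K := hcφ.image_of_continuousOn (c.continuousOn.mono hsub)
  have hKt : K ⊆ c.target := by
    rintro _ ⟨x, hx, rfl⟩; exact c.map_source (hsub hx)
  have hcont : ∀ η : Density n M, ContinuousOn (fun z => (φ (c.symm z) : ℂ) * coeff c η z)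
      c.target := fun η =>
    (Complex.continuous_ofReal.comp_continuousOn
      (φ.contMDiff.continuous.comp_continuousOn c.continuousOn_symm)).mul
      (η.2.2 (chartOf i)).continuousOn
  have hzero : ∀ (η : Density n M), ∀ z ∈ c.target \ K,
      (φ (c.symm z) : ℂ) * coeff c η z = 0 := fun η z hz => by
    have : φ (c.symm z) = 0 := by
      by_contra h
      exact hz.2 ⟨c.symm z, subset_tsupport _ h, c.right_inv hz.1⟩
    rw [this]; simp
  have hint : ∀ η : Density n M, IntegrableOn (fun z => (φ (c.symm z) : ℂ) * coeff c η z)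
      c.target := fun η =>
    (((hcont η).mono hKt).integrableOn_compact hKc).of_forall_sdiff_eq_zero
      c.open_target.measurableSet (hzero η)
  have hKint : ∀ η : Density n M, ∫ z in c.target, (φ (c.symm z) : ℂ) * coeff c η z =
      ∫ z in K, (φ (c.symm z) : ℂ) * coeff c η z := fun η =>
    setIntegral_eq_of_subset_of_forall_sdiff_eq_zero c.open_target.measurableSet hKt (hzero η)
  obtain ⟨B, hB⟩ : ∃ B, ∀ z ∈ K, ‖f (c.symm z)‖ ≤ B := hKc.exists_bound_of_continuousOn
    (((SmoothFun.coords n M).contDiffOn_rep (chartOf i) f).continuousOn.mono hKt)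
  let L : Density n M →ₗ[ℂ] ℂ :=
    { toFun := fun η => ∫ z in c.target, (φ (c.symm z) : ℂ) * coeff c (f.mulDensity η) z
      map_add' := fun η ξ => by
        rw [← integral_add (hint (f.mulDensity η)) (hint (f.mulDensity ξ))]
        refine integral_congr_ae (Eventually.of_forall fun z => ?_)
        change (φ (c.symm z) : ℂ) * (f (c.symm z) * (coeff c η z + coeff c ξ z)) =
          (φ (c.symm z) : ℂ) * (f (c.symm z) * coeff c η z) +
          (φ (c.symm z) : ℂ) * (f (c.symm z) * coeff c ξ z)
        ring
      map_smul' := fun a η => by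
        rw [RingHom.id_apply, smul_eq_mul, ← integral_const_mul]
        refine integral_congr_ae (Eventually.of_forall fun z => ?_)
        change (φ (c.symm z) : ℂ) * (f (c.symm z) * (a * coeff c η z)) =
          a * ((φ (c.symm z) : ℂ) * (f (c.symm z) * coeff c η z))
        ring }
  have hL : Continuous L := by
    have hB0 : ∀ z ∈ K, 0 ≤ B := fun z hz => (norm_nonneg _).trans (hB z hz)
    refine WithSeminorms.continuous_normedSpace_rng ℂ (Density.coords n M).withSeminorms L
      ⟨{⟨chartOf i, ⟨K, hKc, hKt⟩, 0⟩}, ⟨|B| * volume.real K, by positivity⟩, fun η => ?_⟩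
    rw [Finset.sup_singleton]
    change ‖∫ z in c.target, (φ (c.symm z) : ℂ) * coeff c (f.mulDensity η) z‖ ≤
      (|B| * volume.real K) * (Density.coords n M).seminorms ⟨chartOf i, ⟨K, hKc, hKt⟩, 0⟩ η
    rw [hKint, mul_right_comm]
    refine norm_setIntegral_le_of_norm_le_const hKc.measure_lt_top fun z hz => ?_
    have h1 := (Density.coords n M).le_seminorms (chartOf i) (K := K) ⟨hKc, hKt⟩ 0 η hz
    rw [norm_iteratedFDeriv_zero] at h1
    change ‖(φ (c.symm z) : ℂ) * (f (c.symm z) * coeff c η z)‖ ≤ _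
    rw [norm_mul, norm_mul, Complex.norm_real,
      Real.norm_of_nonneg ((chartPartition n M).nonneg i _)]
    refine (mul_le_of_le_one_left (by positivity) ((chartPartition n M).le_one i _)).trans ?_
    exact mul_le_mul ((hB z hz).trans (le_abs_self B)) h1 (norm_nonneg _) (abs_nonneg _)
  exact ⟨⟨L, hL⟩, fun η => rfl⟩

theorem exists_integral (f : SmoothFun n M) :
    ∃ ℓ : Density n M →L[ℂ] ℂ, ∀ η, ℓ η = (f.mulDensity η).integral := by
  choose ℓ hℓ using integral_term f
  refine ⟨∑ i ∈ (finite_partition (n := n) (M := M)).toFinset, ℓ i, fun η => ?_⟩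
  rw [Density.integral, finsum_eq_sum_of_support_subset
    (s := (finite_partition (n := n) (M := M)).toFinset)]
  · simp only [_root_.sum_apply, hℓ]
  · intro i hi
    rw [Set.Finite.coe_toFinset]
    by_contra h
    simp only [mem_ofPred_eq, not_exists, not_not] at h
    exact hi (by simp [h])

/-- The distribution `η ↦ ∫_M f η` defined by a smooth function `f`. -/
noncomputable def SmoothFun.toDistribution (f : SmoothFun n M) : DistributionOn n M where
  toFun η := (f.mulDensity η).integral
  map_add' η ξ := by
    obtain ⟨ℓ, hℓ⟩ := exists_integral f
    simp only [← hℓ, map_add]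
  map_smul' a η := by
    obtain ⟨ℓ, hℓ⟩ := exists_integral f
    simp only [← hℓ, map_smul, RingHom.id_apply]
  cont := by
    obtain ⟨ℓ, hℓ⟩ := exists_integral f
    simpa only [← hℓ] using ℓ.continuous

end Integration

section Diffeo

variable {n : ℕ} {M : Type*} [TopologicalSpace M] [ChartedSpace (Model n) M]

/-- The pull-back `χ^* f = f ∘ χ` of smooth functions. -/
noncomputable def SmoothFun.pullback (χ : M ≃ₘ^∞⟮𝓡 n, 𝓡 n⟯ M) (f : SmoothFun n M) : SmoothFun n M :=
  ⟨fun x => f (χ x), f.contMDiff.comp χ.contMDiff⟩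

/-- The pull-back of densities, `(ψ^* η)_y(v_1, …, v_n) = η_{ψ y}(dψ v_1, …, dψ v_n)`, on
pre-densities. -/
noncomputable def prePullback (ψ : M ≃ₘ^∞⟮𝓡 n, 𝓡 n⟯ M) (η : PreDensity n M) : PreDensity n M :=
  fun y v => η (ψ y) fun i => mfderiv (𝓡 n) (𝓡 n) ψ y (v i)

theorem isDensity_prePullback (ψ : M ≃ₘ^∞⟮𝓡 n, 𝓡 n⟯ M) {η : PreDensity n M}
    (hη : ∀ y, IsDensity (η y)) (y : M) : IsDensity (prePullback ψ η y) := by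
  intro A v
  let e : TangentSpace (𝓡 n) y ≃ₗ[ℝ] TangentSpace (𝓡 n) (ψ y) :=
    (ψ.mfderivToContinuousLinearEquiv (by simp) y).toLinearEquiv
  have he : ∀ w, e w = mfderiv (𝓡 n) (𝓡 n) ψ y w := fun w => rfl
  have h := hη (ψ y) ((e.toLinearMap.comp A).comp e.symm.toLinearMap) fun i => e (v i)
  rw [LinearMap.comp_assoc, LinearMap.det_conj] at h
  have h2 : ∀ i, (e.toLinearMap ∘ₗ A ∘ₗ e.symm.toLinearMap) (e (v i)) = e (A (v i)) :=
    fun i => by simp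
  simp only [h2] at h
  exact h

variable [IsManifold (𝓡 n) ∞ M]

/-- The chart `c ∘ ψ⁻¹`. -/
noncomputable def transportChart (ψ : M ≃ₘ^∞⟮𝓡 n, 𝓡 n⟯ M) (c : SmoothChart n M) : SmoothChart n M :=
  ⟨ψ.symm.toHomeomorph.transOpenPartialHomeomorph c.1,
    OpenPartialHomeomorph.mem_maximalAtlas_of_contMDiffOn _
      ((contMDiffOn_of_mem_maximalAtlas c.2).comp ψ.symm.contMDiff.contMDiffOn fun _ h => h)
      (ψ.contMDiff.comp_contMDiffOn (contMDiffOn_symm_of_mem_maximalAtlas c.2))⟩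

theorem coeff_prePullback (ψ : M ≃ₘ^∞⟮𝓡 n, 𝓡 n⟯ M) (c : SmoothChart n M) (η : PreDensity n M)
    {z : Model n} (hz : z ∈ c.1.target) :
    coeff c.1 (prePullback ψ η) z = coeff (transportChart ψ c).1 η z := by
  have h1 : MDifferentiableAt (𝓡 n) (𝓡 n) c.1.symm z :=
    (contMDiffAt_symm_of_mem_maximalAtlas c.2 hz).mdifferentiableAt (by simp)
  have h2 : MDifferentiableAt (𝓡 n) (𝓡 n) ψ (c.1.symm z) :=
    ψ.contMDiff.contMDiffAt.mdifferentiableAt (by simp)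
  have h3 : ∀ v, mfderiv (𝓡 n) (𝓡 n) ψ (c.1.symm z) (mfderiv (𝓡 n) (𝓡 n) c.1.symm z v) =
      mfderiv (𝓡 n) (𝓡 n) (ψ ∘ c.1.symm) z v := fun v => by
    rw [mfderiv_comp z h2 h1]; rfl
  change η (ψ (c.1.symm z)) (fun i => mfderiv (𝓡 n) (𝓡 n) ψ (c.1.symm z)
    (mfderiv (𝓡 n) (𝓡 n) c.1.symm z (EuclideanSpace.single i (1 : ℝ)))) =
    η (ψ (c.1.symm z)) (fun i => mfderiv (𝓡 n) (𝓡 n) (ψ ∘ c.1.symm) z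
      (EuclideanSpace.single i (1 : ℝ)))
  exact congrArg (η (ψ (c.1.symm z))) (funext fun i => h3 _)

/-- The pull-back of smooth densities, as a linear map. -/
noncomputable def Density.pullbackLinear (ψ : M ≃ₘ^∞⟮𝓡 n, 𝓡 n⟯ M) :
    Density n M →ₗ[ℂ] Density n M where
  toFun η := ⟨prePullback ψ η.1, isDensity_prePullback ψ η.2.1, fun c =>
    (η.2.2 (transportChart ψ c)).congr fun _ hz => coeff_prePullback ψ c η.1 hz⟩
  map_add' _ _ := rfl
  map_smul' _ _ := rfl

theorem Density.continuous_pullbackLinear (ψ : M ≃ₘ^∞⟮𝓡 n, 𝓡 n⟯ M) :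
    Continuous (Density.pullbackLinear ψ) := by
  refine WithSeminorms.continuous_of_isBounded (τ₁₂ := RingHom.id ℂ)
    (Density.coords n M).withSeminorms (Density.coords n M).withSeminorms (Density.pullbackLinear ψ)
    fun ⟨c, ⟨K, hK⟩, k⟩ => ⟨{⟨transportChart ψ c, ⟨K, hK⟩, k⟩}, 1, fun η => ?_⟩
  rw [Finset.sup_singleton, one_smul]
  refine (Density.coords n M).seminorms_le c hK k _ (apply_nonneg _ _) fun z hz => ?_
  refine le_of_eq_of_le ?_
    ((Density.coords n M).le_seminorms (transportChart ψ c) hK k η hz)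
  have heq : (Density.coords n M).rep c (Density.pullbackLinear ψ η) =ᶠ[𝓝 z]
      (Density.coords n M).rep (transportChart ψ c) η := by
    filter_upwards [c.1.open_target.mem_nhds (hK.2 hz)] with w hw
    exact coeff_prePullback ψ c η.1 hw
  exact congrArg norm (heq.iteratedFDeriv ℝ k).eq_of_nhds

/-- The pull-back of smooth densities. -/
noncomputable def Density.pullback (ψ : M ≃ₘ^∞⟮𝓡 n, 𝓡 n⟯ M) : Density n M →L[ℂ] Density n M :=
  ⟨Density.pullbackLinear ψ, Density.continuous_pullbackLinear ψ⟩

/-- The pull-back of distributions, `⟨χ^* u, η⟩ = ⟨u, (χ⁻¹)^* η⟩`. -/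
noncomputable def pullbackDistribution (χ : M ≃ₘ^∞⟮𝓡 n, 𝓡 n⟯ M) (u : DistributionOn n M) :
    DistributionOn n M :=
  u.comp (Density.pullback χ.symm)

/-- The push-forward `χ_* T = (χ⁻¹)^* ∘ T ∘ χ^*` of smoothing operators, whose kernel at
`(x, y)` is the push-forward by `χ` of the density `k_T (χ⁻¹ x, ·)`. -/
noncomputable def SmoothingOp.pushforward (χ : M ≃ₘ^∞⟮𝓡 n, 𝓡 n⟯ M) (T : SmoothingOp n M) :
    SmoothingOp n M :=
  ⟨fun x => prePullback χ.symm (T.1 (χ.symm x)),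
    fun x => isDensity_prePullback χ.symm (T.2.1 (χ.symm x)),
    fun c c' => (T.2.2 (transportChart χ.symm c) (transportChart χ.symm c')).congr fun _ hp =>
      coeff_prePullback χ.symm c' _ hp.2⟩

theorem SmoothingOp.pushforward_apply (χ : M ≃ₘ^∞⟮𝓡 n, 𝓡 n⟯ M) (T : SmoothingOp n M)
    (u : DistributionOn n M) :
    (T.pushforward χ).apply u = (T.apply (pullbackDistribution χ u)).pullback χ.symm :=
  rfl

/-- The action of a diffeomorphism on maps `φ : Ψ^{-∞}(M) → C^∞(M)`: `χ^* φ = χ^* ∘ φ ∘ χ_*`. -/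
noncomputable def pullbackMap (χ : M ≃ₘ^∞⟮𝓡 n, 𝓡 n⟯ M) (φ : SmoothingOp n M → SmoothFun n M) :
    SmoothingOp n M → SmoothFun n M :=
  fun T => (φ (T.pushforward χ)).pullback χ

end Diffeo

section Algebras

variable {n : ℕ} {M : Type*} [TopologicalSpace M] [ChartedSpace (Model n) M]

theorem IsModerateNet.const {X : Type*} [AddCommGroup X] [Module ℂ X] [TopologicalSpace X]
    (b : X) : IsModerateNet fun _ => b :=
  ⟨fun _ => FrechetContDiffOn.const _ _, fun ρ _ => ⟨0, by
    simpa only [zpow_zero] using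
      Asymptotics.isBigO_const_const (ρ b) (one_ne_zero (α := ℝ)) (𝓝[>] (0 : ℝ))⟩⟩

theorem isBigO_zpow_of_le {a b : ℤ} (h : b ≤ a) :
    (fun ε : ℝ => ε ^ a) =O[𝓝[>] 0] fun ε : ℝ => ε ^ b := by
  refine Asymptotics.IsBigO.of_bound 1 ?_
  filter_upwards [Ioo_mem_nhdsGT (zero_lt_one' ℝ)] with ε hε
  rw [one_mul, Real.norm_of_nonneg (zpow_nonneg hε.1.le _),
    Real.norm_of_nonneg (zpow_nonneg hε.1.le _)]
  exact zpow_le_zpow_right_of_le_one₀ hε.1 hε.2.le h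

theorem isBigO_zpow_mul {f g : ℝ → ℝ} {a b : ℤ} (hf : f =O[𝓝[>] 0] fun ε : ℝ => ε ^ a)
    (hg : g =O[𝓝[>] 0] fun ε : ℝ => ε ^ b) :
    (fun ε => f ε * g ε) =O[𝓝[>] 0] fun ε : ℝ => ε ^ (a + b) := by
  refine (hf.mul hg).congr' EventuallyEq.rfl ?_
  filter_upwards [self_mem_nhdsWithin] with ε hε
  rw [zpow_add₀ (ne_of_gt hε)]

theorem IsModerateNet.add {x y : ℝ → SmoothFun n M} (hx : IsModerateNet x)
    (hy : IsModerateNet y) : IsModerateNet fun ε => x ε + y ε := by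
  refine ⟨fun m => (hx.1 m).add (hy.1 m), fun ρ hρ => ?_⟩
  obtain ⟨a, ha⟩ := hx.2 ρ hρ
  obtain ⟨b, hb⟩ := hy.2 ρ hρ
  refine ⟨min a b, Asymptotics.IsBigO.trans (g := fun ε => ρ (x ε) + ρ (y ε)) ?_
    ((ha.trans (isBigO_zpow_of_le (min_le_left a b))).add
      (hb.trans (isBigO_zpow_of_le (min_le_right a b))))⟩
  refine Asymptotics.isBigO_of_le _ fun ε => ?_
  rw [Real.norm_of_nonneg (apply_nonneg _ _),
    Real.norm_of_nonneg (add_nonneg (apply_nonneg _ _) (apply_nonneg _ _))]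
  exact map_add_le_add ρ _ _

theorem seminorm_mul_isBigO {x y : ℝ → SmoothFun n M} {ρ q : Seminorm ℂ (SmoothFun n M)}
    (h : ∀ f g, ρ (f * g) ≤ q f * q g) :
    (fun ε => ρ (x ε * y ε)) =O[𝓝[>] 0] fun ε => q (x ε) * q (y ε) := by
  refine Asymptotics.isBigO_of_le _ fun ε => ?_
  rw [Real.norm_of_nonneg (apply_nonneg _ _),
    Real.norm_of_nonneg (mul_nonneg (apply_nonneg _ _) (apply_nonneg _ _))]
  exact h _ _

theorem IsModerateNet.mul {x y : ℝ → SmoothFun n M} (hx : IsModerateNet x)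
    (hy : IsModerateNet y) : IsModerateNet fun ε => x ε * y ε := by
  refine ⟨fun m => (hx.1 m).mul (hy.1 m), fun ρ hρ => ?_⟩
  obtain ⟨q, hq, hle⟩ := SmoothFun.exists_seminorm_mul_le ρ hρ
  obtain ⟨a, ha⟩ := hx.2 q hq
  obtain ⟨b, hb⟩ := hy.2 q hq
  exact ⟨a + b, (seminorm_mul_isBigO hle).trans (isBigO_zpow_mul ha hb)⟩

theorem IsNegligibleNet.zero {X : Type*} [AddCommGroup X] [Module ℂ X] [TopologicalSpace X] :
    IsNegligibleNet fun _ => (0 : X) :=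
  ⟨fun _ => FrechetContDiffOn.const _ _, fun ρ _ N => by
    simpa using Asymptotics.isBigO_zero (fun ε : ℝ => ε ^ N) (𝓝[>] 0)⟩

theorem IsNegligibleNet.add {x y : ℝ → SmoothFun n M} (hx : IsNegligibleNet x)
    (hy : IsNegligibleNet y) : IsNegligibleNet fun ε => x ε + y ε := by
  refine ⟨fun m => (hx.1 m).add (hy.1 m), fun ρ hρ N => ?_⟩
  refine Asymptotics.IsBigO.trans (g := fun ε => ρ (x ε) + ρ (y ε)) ?_
    ((hx.2 ρ hρ N).add (hy.2 ρ hρ N))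
  refine Asymptotics.isBigO_of_le _ fun ε => ?_
  rw [Real.norm_of_nonneg (apply_nonneg _ _),
    Real.norm_of_nonneg (add_nonneg (apply_nonneg _ _) (apply_nonneg _ _))]
  exact map_add_le_add ρ _ _

theorem IsModerateNet.mul_negligible {x y : ℝ → SmoothFun n M} (hx : IsModerateNet x)
    (hy : IsNegligibleNet y) : IsNegligibleNet fun ε => x ε * y ε := by
  refine ⟨fun m => (hx.1 m).mul (hy.1 m), fun ρ hρ N => ?_⟩
  obtain ⟨q, hq, hle⟩ := SmoothFun.exists_seminorm_mul_le ρ hρ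
  obtain ⟨a, ha⟩ := hx.2 q hq
  have h := (seminorm_mul_isBigO (x := x) (y := y) hle).trans
    (isBigO_zpow_mul ha (hy.2 q hq (N - a)))
  rwa [add_sub_cancel] at h

variable (n M)

/-- `E^∞(M)`: the algebra (under pointwise operations) of smooth maps
`Ψ^{-∞}(M) → C^∞(M)` between Fréchet spaces. -/
noncomputable def smoothMaps : Subalgebra ℂ (SmoothingOp n M → SmoothFun n M) where
  carrier := {φ | FrechetSmoothOn φ univ}
  mul_mem' hf hg := fun m => (hf m).mul (hg m)
  add_mem' hf hg := fun m => (hf m).add (hg m)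
  algebraMap_mem' a := fun _ => FrechetContDiffOn.const (algebraMap ℂ (SmoothFun n M) a) _

variable {n M}

/-- `E_𝓛(M)`: the algebra of maps `φ ∈ E^∞(M)` that are moderate over the set `𝓛` of nets of
smoothing operators, i.e. `ε ↦ φ(T_ε)` is a moderate net in `C^∞(M)` for all `T ∈ 𝓛`. -/
noncomputable def moderateMaps (𝓛 : Set (ℝ → SmoothingOp n M)) :
    Subalgebra ℂ (SmoothingOp n M → SmoothFun n M) where
  carrier := {φ | φ ∈ smoothMaps n M ∧ ∀ T ∈ 𝓛, IsModerateNet fun ε => φ (T ε)}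
  mul_mem' hf hg := ⟨mul_mem hf.1 hg.1, fun T hT => (hf.2 T hT).mul (hg.2 T hT)⟩
  add_mem' hf hg := ⟨add_mem hf.1 hg.1, fun T hT => (hf.2 T hT).add (hg.2 T hT)⟩
  algebraMap_mem' a := ⟨algebraMap_mem _ a, fun _ _ => IsModerateNet.const _⟩

/-- `N_𝓛(M)`: the ideal of maps that are negligible over `𝓛`, i.e. `ε ↦ φ(T_ε)` is a negligible net
in `C^∞(M)` for all `T ∈ 𝓛`. -/
def negligibleMaps (𝓛 : Set (ℝ → SmoothingOp n M)) : Ideal (moderateMaps 𝓛) where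
  carrier := {φ | ∀ T ∈ 𝓛, IsNegligibleNet fun ε => φ.1 (T ε)}
  add_mem' hf hg := fun T hT => (hf T hT).add (hg T hT)
  zero_mem' := fun _ _ => IsNegligibleNet.zero
  smul_mem' φ _ hg := fun T hT => (φ.2.2 T hT).mul_negligible (hg T hT)

/-- `𝓖_𝓛(M) = E_𝓛(M) / N_𝓛(M)`: the full algebra of generalized functions over `𝓛`. -/
abbrev GeneralizedFun (𝓛 : Set (ℝ → SmoothingOp n M)) : Type _ :=
  moderateMaps 𝓛 ⧸ negligibleMaps 𝓛

variable (n M) [IsManifold (𝓡 n) ∞ M] [CompactSpace M] [T2Space M]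

/-- `𝓤(M)`: the set of moderate approximate units. Convergence `T_ε u → u` in `D'(M)` is
convergence of the pairings with every smooth density. -/
def moderateApproximateUnits : Set (ℝ → SmoothingOp n M) :=
  {T | IsModerateNet T ∧
    (∀ (u : DistributionOn n M) (η : Density n M),
      Tendsto (fun ε => ((T ε).apply u).toDistribution η) (𝓝[>] 0) (𝓝 (u η))) ∧
    ∀ f : SmoothFun n M, ∀ ρ : Seminorm ℂ (SmoothFun n M), Continuous ρ → ∀ N : ℤ,
      (fun ε => ρ ((T ε).apply f.toDistribution - f)) =O[𝓝[>] 0] fun ε : ℝ => ε ^ N}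

end Algebras

end GenFun

open GenFun

/-! Everything rests on one analytic fact: for a fixed distribution `u`, the map `T ↦ T u` from
smoothing operators to smooth functions is linear and continuous (`SmoothingOp.applyCLM`). By
continuity, `u` is bounded by finitely many seminorms, each a supremum of `l`-th derivatives in a
chart over a compact set. By Hahn-Banach it therefore factors through a finite product of spaces of
continuous functions. Bounded functionals commute with differentiation in the parameter `x`, so the
`k`-th derivatives of `x ↦ ⟨u, k_T(x, ·)⟩` on a compact set are controlled by finitely many
derivatives of `k_T`, of orders `k + l`, on products of compact sets. These are seminorms of `T`.

A continuous linear map is smooth and carries moderate nets to moderate nets, which gives membership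
of `Θ_u` in `E^∞` and in every `E_𝓛`. As a map into `E^∞`, `u ↦ Θ_u` is injective because kernels
that do not depend on `x` already recover `u`.

For injectivity into the quotient, a single net in `𝓛` suffices. If `T_ε u` is negligible, it tends
to `0` in `C^∞(M)`, hence weakly as a distribution; it also tends to `u`, and limits are unique. For
multiplicativity on `C^∞(M)`, the third condition on approximate units says that `Θ_f` and the
constant map `f` differ by a negligible map; constant maps form a copy of the algebra `C^∞(M)`.

Equivariance is a formal computation. That `χ^*` preserves `E^∞` follows from continuity of `χ_*` on
operators and `χ^*` on functions: `χ` permutes the maximal atlas, so it only relabels the defining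
seminorms. -/

namespace GenFun

/-! ### Mixed partial derivatives against total derivatives. -/

section PartialDerivatives

variable {E E' A : Type*} [NormedAddCommGroup E] [NormedSpace ℝ E] [NormedAddCommGroup E']
  [NormedSpace ℝ E'] [NormedAddCommGroup A] [NormedSpace ℝ A]

/-- Chain rule for the affine map `y ↦ a + B y`: the translation is absorbed into `f` and the open
set, leaving only the linear part. It serves to slice a function on a product along either factor.
-/
theorem iteratedFDeriv_comp_add_clm {f : E → A} {s : Set E} (hs : IsOpen s)
    (hf : ContDiffOn ℝ ∞ f s) (a : E) (B : E' →L[ℝ] E) (k : ℕ) {x : E'} (hx : a + B x ∈ s) :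
    iteratedFDeriv ℝ k (fun y => f (a + B y)) x =
      (iteratedFDeriv ℝ k f (a + B x)).compContinuousLinearMap fun _ => B := by
  set s' : Set E := (fun y => a + y) ⁻¹' s with hs'
  have hs'o : IsOpen s' := hs.preimage (by fun_prop)
  have hg : ContDiffOn ℝ ∞ (fun y => f (a + y)) s' :=
    hf.comp (by fun_prop) fun _ h => h
  have h := B.iteratedFDerivWithin_comp_right hg hs'o.uniqueDiffOn
    (hs'o.preimage B.continuous).uniqueDiffOn (x := x) hx (i := k) (by exact_mod_cast le_top)
  rw [iteratedFDerivWithin_of_isOpen k (hs'o.preimage B.continuous) hx,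
    iteratedFDerivWithin_of_isOpen k hs'o hx, iteratedFDeriv_comp_add_left] at h
  exact h

theorem norm_iteratedFDeriv_iteratedFDeriv_succ (f : E → A) (k l : ℕ) (x : E) :
    ‖iteratedFDeriv ℝ k (iteratedFDeriv ℝ (l + 1) f) x‖ =
      ‖iteratedFDeriv ℝ k (fderiv ℝ (iteratedFDeriv ℝ l f)) x‖ := by
  have h := LinearIsometryEquiv.norm_iteratedFDeriv_comp_left (𝕜 := ℝ) (E := E)
    (F := E →L[ℝ] E [×l]→L[ℝ] A) (G := E [×(l + 1)]→L[ℝ] A)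
    (continuousMultilinearCurryLeftEquiv ℝ (fun _ : Fin (l + 1) => E) A).symm
    (fderiv ℝ (iteratedFDeriv ℝ l f)) x k
  rw [iteratedFDeriv_succ_eq_comp_left]
  exact h

/-- The two derivatives live in different spaces of multilinear maps, identified by currying.
Currying is a linear isometry, so the norms can be compared without naming the identification. -/
theorem norm_iteratedFDeriv_iteratedFDeriv (f : E → A) (l : ℕ) : ∀ (k : ℕ) (x : E),
    ‖iteratedFDeriv ℝ k (iteratedFDeriv ℝ l f) x‖ = ‖iteratedFDeriv ℝ (k + l) f x‖ := by
  induction l with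
  | zero =>
    intro k x
    rw [iteratedFDeriv_zero_eq_comp]
    exact LinearIsometryEquiv.norm_iteratedFDeriv_comp_left _ _ _ _
  | succ l ih =>
    intro k x
    rw [norm_iteratedFDeriv_iteratedFDeriv_succ, norm_iteratedFDeriv_fderiv, ih, add_right_comm, add_assoc]

variable {G W : Type*} [NormedAddCommGroup G] [NormedSpace ℝ G] [NormedAddCommGroup W]
  [NormedSpace ℝ W]

/-- A partial derivative is a total derivative restricted along the inclusion of one factor, and
both inclusions have norm at most one. Applying this to `W` and then to `G` costs no constant. -/
theorem norm_partial_iteratedFDeriv_le {g : G → W → A} {U : Set G} {D : Set W} (hU : IsOpen U)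
    (hD : IsOpen D) (hg : ContDiffOn ℝ ∞ (fun p : G × W => g p.1 p.2) (U ×ˢ D)) (k l : ℕ)
    {z : G} {w : W} (hz : z ∈ U) (hw : w ∈ D) :
    ‖iteratedFDeriv ℝ k (fun z => iteratedFDeriv ℝ l (g z) w) z‖ ≤
      ‖iteratedFDeriv ℝ (k + l) (fun p : G × W => g p.1 p.2) (z, w)‖ := by
  have hUD : IsOpen (U ×ˢ D) := hU.prod hD
  set f : G × W → A := fun p => g p.1 p.2 with hf
  have hsplit : ∀ (z : G) (w : W), ((z, (0 : W)) + ContinuousLinearMap.inr ℝ G W w) = (z, w) := by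
    simp
  have hsplit' : ∀ (z : G) (w : W), (((0 : G), w) + ContinuousLinearMap.inl ℝ G W z) = (z, w) := by
    simp
  have hinr : ∀ z ∈ U, iteratedFDeriv ℝ l (g z) w =
      ContinuousMultilinearMap.compContinuousLinearMapL (F := A)
        (fun _ : Fin l => ContinuousLinearMap.inr ℝ G W) (iteratedFDeriv ℝ l f (z, w)) := by
    intro z hz
    have h := iteratedFDeriv_comp_add_clm hUD hg (z, 0) (ContinuousLinearMap.inr ℝ G W) l (x := w)
      (by rw [hsplit]; exact ⟨hz, hw⟩)
    simp only [hsplit] at h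
    exact h
  -- The formula is needed on a neighbourhood of `z`, since it is differentiated `k` more times in
  -- `z`.
  have hev : (fun z => iteratedFDeriv ℝ l (g z) w) =ᶠ[𝓝 z]
      (ContinuousMultilinearMap.compContinuousLinearMapL (F := A)
        (fun _ : Fin l => ContinuousLinearMap.inr ℝ G W)) ∘ fun z => iteratedFDeriv ℝ l f (z, w) := by
    filter_upwards [hU.mem_nhds hz] with z' hz' using hinr z' hz'
  have hfl : ContDiffOn ℝ ∞ (iteratedFDeriv ℝ l f) (U ×ˢ D) := contDiffOn_infty.2 fun m p hp =>
    (((hg.contDiffAt (hUD.mem_nhds hp)).of_le (m := (m + l : ℕ)) (by exact_mod_cast le_top)).iteratedFDeriv_right (m := m) (i := l)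
      (by simp)).contDiffWithinAt
  have hinl := iteratedFDeriv_comp_add_clm hUD hfl (0, w) (ContinuousLinearMap.inl ℝ G W) k (x := z)
      (by rw [hsplit']; exact ⟨hz, hw⟩)
  simp only [hsplit'] at hinl
  have hd : ContDiffAt ℝ k (fun z => iteratedFDeriv ℝ l f (z, w)) z :=
    (((hfl.contDiffAt (hUD.mem_nhds (⟨hz, hw⟩ : (z, w) ∈ U ×ˢ D))).comp z
      (contDiffAt_id.prodMk contDiffAt_const)).of_le (by exact_mod_cast le_top))
  rw [(hev.iteratedFDeriv ℝ k).eq_of_nhds]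
  refine (ContinuousLinearMap.norm_iteratedFDeriv_comp_left _ hd le_rfl).trans ?_
  rw [hinl, ← norm_iteratedFDeriv_iteratedFDeriv]
  refine (mul_le_of_le_one_left (norm_nonneg _) ?_).trans
    ((ContinuousMultilinearMap.norm_compContinuousLinearMap_le _ _).trans
      (mul_le_of_le_one_right (norm_nonneg _) ?_))
  · exact (ContinuousMultilinearMap.norm_compContinuousLinearMapL_le A _).trans
      (Finset.prod_le_one (fun _ _ => norm_nonneg _)
        fun _ _ => ContinuousLinearMap.norm_inr_le_one ℝ G W)
  · exact Finset.prod_le_one (fun _ _ => norm_nonneg _)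
        fun _ _ => ContinuousLinearMap.norm_inl_le_one ℝ G W

end PartialDerivatives

/-! ### Derivative bounds for functionals applied to smooth families. -/

/-- Hahn-Banach gives `u = u₂ ∘ L` with `u₂` bounded, and `u₂` passes through derivatives at the
cost of its norm. The constant is chosen before the family `F`; this uniformity is what later yields
continuity in `T`. The bound on `L ∘ F` is asked for vector by vector so that it can be checked
coordinate by coordinate. -/
theorem exists_norm_iteratedFDeriv_comp_le {V X : Type*} [AddCommGroup V] [Module ℂ V]
    [NormedAddCommGroup X] [NormedSpace ℂ X] [NormedSpace ℝ X] [IsScalarTower ℝ ℂ X]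
    (u : V →ₗ[ℂ] ℂ) (L : V →ₗ[ℂ] X) (B : ℝ) (hBL : ∀ v, ‖u v‖ ≤ B * ‖L v‖) :
    ∃ B' : ℝ, 0 ≤ B' ∧ ∀ {G : Type} [NormedAddCommGroup G] [NormedSpace ℝ G] (F : G → V) (z : G)
      (k : ℕ), ContDiffAt ℝ k (fun z => L (F z)) z → ∀ R, 0 ≤ R →
      (∀ v, ‖iteratedFDeriv ℝ k (fun z => L (F z)) z v‖ ≤ R * ∏ i, ‖v i‖) →
      ‖iteratedFDeriv ℝ k (fun z => u (F z)) z‖ ≤ B' * R := by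
  obtain ⟨u₂, hu₂⟩ := exists_dual_factorization u L B hBL
  refine ⟨‖u₂.restrictScalars ℝ‖, norm_nonneg _, fun F z k hF R hR h => ?_⟩
  have hu : (fun z => u (F z)) = u₂.restrictScalars ℝ ∘ fun z => L (F z) :=
    funext fun z => hu₂ (F z)
  rw [hu]
  exact ((u₂.restrictScalars ℝ).norm_iteratedFDeriv_comp_left hF le_rfl).trans
    (mul_le_mul_of_nonneg_left (ContinuousMultilinearMap.opNorm_le_bound hR h) (norm_nonneg _))

/-- A quantitative form of `CoordSystem.contDiffOn_apply`. -/
theorem CoordSystem.exists_norm_iteratedFDeriv_apply_le {J V : Type*} {W G : Type}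
    [NormedAddCommGroup W] [NormedSpace ℝ W] [NormedAddCommGroup G] [NormedSpace ℝ G]
    [AddCommGroup V] [Module ℂ V] (C : CoordSystem J W V) (u : V →ₗ[ℂ] ℂ)
    (hu : @Continuous V ℂ C.topology _ u) {U : Set G} (hU : IsOpen U) (k : ℕ) :
    ∃ (s : Finset (Σ j : J, {K : Set W // IsCompact K ∧ K ⊆ C.dom j} × ℕ)) (B : ℝ), 0 ≤ B ∧
      ∀ (F : G → V),
        (∀ j, ContDiffOn ℝ ∞ (fun p : G × W => C.rep j (F p.1) p.2) (U ×ˢ C.dom j)) →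
        ∀ z ∈ U, ∀ R, 0 ≤ R → (∀ i ∈ s, ∀ w ∈ i.2.1.1, ‖iteratedFDeriv ℝ (k + i.2.2)
            (fun p : G × W => C.rep i.1 (F p.1) p.2) (z, w)‖ ≤ R) →
          ‖iteratedFDeriv ℝ k (fun z => u (F z)) z‖ ≤ B * R := by
  let _ := C.topology
  obtain ⟨s, B, -, hB⟩ := Seminorm.bound_of_continuous C.withSeminorms
    ((normSeminorm ℂ ℂ).comp u) (continuous_norm.comp hu)
  have hB' : ∀ v, ‖u v‖ ≤ B * (s.sup C.seminorms) v := fun v => hB v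
  have : ∀ i : s, CompactSpace (i.1.2.1 : Set W) :=
    fun i => isCompact_iff_compactSpace.1 i.1.2.1.2.1
  have hc : ∀ (v : V) (i : s), Continuous fun z : (i.1.2.1 : Set W) =>
      iteratedFDeriv ℝ i.1.2.2 (C.rep i.1.1 v) z := fun v i =>
    (continuousOn_iteratedFDeriv (C.isOpen_dom _) (C.contDiffOn_rep i.1.1 v) _).comp_continuous
      continuous_subtype_val fun z => i.1.2.1.2.2 z.2
  have hat : ∀ (v : V) (i : s) (z : (i.1.2.1 : Set W)),
      ContDiffAt ℝ i.1.2.2 (C.rep i.1.1 v) z := fun v i z =>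
    contDiffAt_of_open (C.isOpen_dom _) (C.contDiffOn_rep i.1.1 v) _ (i.1.2.1.2.2 z.2)
  -- `L` records exactly the derivatives entering the finitely many seminorms that bound `u`, so its
  -- sup norm dominates them.
  let L : V →ₗ[ℂ] (∀ i : s, C((i.1.2.1 : Set W), W [×i.1.2.2]→L[ℝ] ℂ)) :=
    { toFun := fun v i => ⟨fun z => iteratedFDeriv ℝ i.1.2.2 (C.rep i.1.1 v) z, hc v i⟩
      map_add' := fun v w => by
        funext i; ext1 z
        simp only [map_add, ContinuousMap.coe_mk, Pi.add_apply, ContinuousMap.add_apply]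
        exact iteratedFDeriv_add_apply (hat v i z) (hat w i z)
      map_smul' := fun a v => by
        funext i; ext1 z
        simp only [map_smul, ContinuousMap.coe_mk, Pi.smul_apply, ContinuousMap.smul_apply,
          RingHom.id_apply]
        exact iteratedFDeriv_const_smul_apply (hat v i z) }
  have hL : ∀ v, (s.sup C.seminorms) v ≤ ‖L v‖ := fun v => by
    refine Seminorm.finset_sup_apply_le (norm_nonneg _) fun i hi => ?_
    refine C.seminorms_le i.1 i.2.1.2 i.2.2 v (norm_nonneg _) fun z hz => ?_
    exact ((L v ⟨i, hi⟩).norm_coe_le_norm ⟨z, hz⟩).trans (norm_le_pi_norm (L v) ⟨i, hi⟩)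
  have hBL : ∀ v, ‖u v‖ ≤ (B : ℝ) * ‖L v‖ := fun v => (hB' v).trans <|
    mul_le_mul_of_nonneg_left (hL v) B.2
  have hst : IsScalarTower ℝ ℂ (∀ i : s, C((i.1.2.1 : Set W), W [×i.1.2.2]→L[ℝ] ℂ)) :=
    ⟨fun a b x => funext fun i => ContinuousMap.ext fun w => smul_assoc a b (x i w)⟩
  obtain ⟨B', hB'0, hfin⟩ := @exists_norm_iteratedFDeriv_comp_le V
    (∀ i : s, C((i.1.2.1 : Set W), W [×i.1.2.2]→L[ℝ] ℂ)) _ _ _ _ _ hst u L B hBL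
  refine ⟨s, B', hB'0, fun F hF z hz R hR hs => ?_⟩
  have hLF : ContDiffOn ℝ k (fun z => L (F z)) U := by
    rw [contDiffOn_pi]
    intro i
    exact contDiffOn_toContinuousMap hU (C.isOpen_dom i.1.1) i.1.2.1.2.2 k
      (contDiffOn_partial_iteratedFDeriv (g := fun z => C.rep i.1.1 (F z)) hU (C.isOpen_dom i.1.1)
        (hF i.1.1) i.1.2.2)
      (fun z => L (F z) i) fun z _ w => rfl
  have hLFz := hLF.contDiffAt (hU.mem_nhds hz)
  refine hfin F z k hLFz R hR fun v => ?_
  have hRv : 0 ≤ R * ∏ i, ‖v i‖ := by positivity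
  rw [pi_norm_le_iff_of_nonneg hRv]
  intro i
  rw [ContinuousMap.norm_le _ hRv]
  intro w
  -- Evaluation at the index `i` and the point `w` is continuous and linear, so it commutes with the
  -- `k`-th derivative in `z`. What remains is a mixed partial derivative of the local
  -- representation.
  let ev : (∀ i : s, C((i.1.2.1 : Set W), W [×i.1.2.2]→L[ℝ] ℂ)) →L[ℝ] (W [×i.1.2.2]→L[ℝ] ℂ) :=
    (ContinuousMap.evalCLM ℝ w).comp (ContinuousLinearMap.proj i)
  have h1 := ev.iteratedFDeriv_comp_left hLFz (i := k) le_rfl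
  have h2 : iteratedFDeriv ℝ k (fun z => L (F z)) z v i w =
      iteratedFDeriv ℝ k (ev ∘ fun z => L (F z)) z v := by
    rw [h1]; rfl
  rw [h2]
  refine (ContinuousMultilinearMap.le_opNorm _ v).trans
    (mul_le_mul_of_nonneg_right ?_ (by positivity))
  exact (norm_partial_iteratedFDeriv_le (g := fun z => C.rep i.1.1 (F z)) hU (C.isOpen_dom i.1.1)
    (hF i.1.1) k i.1.2.2 hz (i.1.2.1.2.2 w.2)).trans (hs i.1 i.2 w w.2)

/-! ### Continuous linear maps, smoothness and moderate nets. -/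

section FrechetSmooth

universe u v w

/-- The derivative `(x, h) ↦ A h` is again a continuous linear map, now on `E × E`, so the induction
closes. -/
theorem FrechetContDiffOn.clm {m : ℕ} : ∀ {E : Type u} {F : Type v} [AddCommGroup E] [Module ℝ E]
    [TopologicalSpace E] [AddCommGroup F] [Module ℝ F] [TopologicalSpace F]
    (A : E →L[ℝ] F) (U : Set E), FrechetContDiffOn m (fun x => A x) U := by
  induction m with
  | zero => intro E F _ _ _ _ _ _ A U; exact A.continuous.continuousOn
  | succ m ih =>
    intro E F _ _ _ _ _ _ A U
    refine ⟨A.continuous.continuousOn, fun p => A p.2, fun x _ h => ?_,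
      ih (A.comp (ContinuousLinearMap.snd ℝ E E)) _⟩
    refine tendsto_const_nhds.congr' ?_
    filter_upwards [self_mem_nhdsWithin] with t ht
    rw [map_add, map_smul, add_sub_cancel_left, inv_smul_smul₀ (by simpa using ht)]

theorem FrechetContDiffOn.clm_comp {m : ℕ} : ∀ {E : Type u} {F : Type v} {F' : Type w}
    [AddCommGroup E] [Module ℝ E] [TopologicalSpace E] [AddCommGroup F] [Module ℝ F]
    [TopologicalSpace F] [AddCommGroup F'] [Module ℝ F'] [TopologicalSpace F'] {f : E → F}
    {U : Set E} (A : F →L[ℝ] F'), FrechetContDiffOn m f U →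
    FrechetContDiffOn m (fun x => A (f x)) U := by
  induction m with
  | zero =>
    intro E F F' _ _ _ _ _ _ _ _ _ f U A hf
    exact A.continuous.comp_continuousOn hf
  | succ m ih =>
    intro E F F' _ _ _ _ _ _ _ _ _ f U A hf
    obtain ⟨h0, df, h1, h2⟩ := hf
    refine ⟨A.continuous.comp_continuousOn h0, fun p => A (df p), fun x hx h => ?_, ih A h2⟩
    refine ((A.continuous.tendsto _).comp (h1 x hx h)).congr fun t => ?_
    simp only [Function.comp_apply, map_smul, map_sub]

end FrechetSmooth

/-- A continuous seminorm composed with `A` is a continuous seminorm on the source, so the growth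
condition is inherited verbatim. -/
theorem IsModerateNet.clm_comp {X Y : Type*} [AddCommGroup X] [Module ℂ X] [TopologicalSpace X]
    [AddCommGroup Y] [Module ℂ Y] [TopologicalSpace Y] {x : ℝ → X} (hx : IsModerateNet x)
    (A : X →L[ℂ] Y) : IsModerateNet fun ε => A (x ε) :=
  ⟨fun m => (hx.1 m).clm_comp (A.restrictScalars ℝ), fun ρ hρ =>
    hx.2 (ρ.comp A.toLinearMap) (hρ.comp A.continuous)⟩

/-! ### Continuity of the basic operations; the evaluation map into `E^∞`. -/

section Continuity

variable {n : ℕ} {M : Type*} [TopologicalSpace M] [ChartedSpace (Model n) M]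

theorem IsNegligibleNet.tendsto_zero {x : ℝ → SmoothFun n M} (hx : IsNegligibleNet x) :
    Tendsto x (𝓝[>] 0) (𝓝 0) := by
  rw [(SmoothFun.coords n M).withSeminorms.tendsto_nhds]
  intro i e he
  -- Of all the decay rates available, `N = 1` is enough for convergence.
  have h0 : Tendsto (fun ε : ℝ => ε ^ (1 : ℤ)) (𝓝[>] 0) (𝓝 0) := by
    simp only [zpow_one]
    exact tendsto_nhdsWithin_of_tendsto_nhds tendsto_id
  have h := (hx.2 _ ((SmoothFun.coords n M).withSeminorms.continuous_seminorm i) 1).trans_tendsto h0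
  filter_upwards [h.eventually_lt_const he] with ε hε
  rwa [sub_zero]

/-- Multiplication of smooth functions by a fixed smooth density. -/
def SmoothFun.mulDensityLinear (η : Density n M) : SmoothFun n M →ₗ[ℂ] Density n M where
  toFun f := f.mulDensity η
  map_add' f g := Subtype.ext <| funext fun y => funext fun v => add_mul (f y) (g y) (η y v)
  map_smul' a f := Subtype.ext <| funext fun y => funext fun v => mul_assoc a (f y) (η y v)

/-- Leibniz rule in a chart. The factor in front of `S` depends only on `η`, so for fixed `η` this
is a continuity estimate in `f`. -/
theorem SmoothFun.seminorms_mulDensity_le (η : Density n M) (f : SmoothFun n M)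
    (c : SmoothChart n M) {K : Set (Model n)} (hK : IsCompact K ∧ K ⊆ c.1.target) (k : ℕ) {S : ℝ}
    (hS : ∀ l ∈ Finset.range (k + 1), (SmoothFun.coords n M).seminorms ⟨c, ⟨K, hK⟩, l⟩ f ≤ S) :
    (Density.coords n M).seminorms ⟨c, ⟨K, hK⟩, k⟩ (f.mulDensity η) ≤
      (∑ l ∈ Finset.range (k + 1),
        (k.choose l : ℝ) * (Density.coords n M).seminorms ⟨c, ⟨K, hK⟩, k - l⟩ η) * S := by
  set C := SmoothFun.coords n M
  set D := Density.coords n M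
  have hS0 : 0 ≤ S := (apply_nonneg _ _).trans (hS 0 (by simp))
  refine D.seminorms_le c hK k _ (mul_nonneg (Finset.sum_nonneg fun _ _ =>
    mul_nonneg (Nat.cast_nonneg _) (apply_nonneg _ _)) hS0) fun z hz => ?_
  have hzU : z ∈ C.dom c := hK.2 hz
  have hopen := C.isOpen_dom c
  have h1 := norm_iteratedFDerivWithin_mul_le (C.contDiffOn_rep c f) (D.contDiffOn_rep c η)
    hopen.uniqueDiffOn hzU (n := k) (by exact_mod_cast le_top)
  simp only [iteratedFDerivWithin_of_isOpen _ hopen hzU] at h1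
  refine h1.trans ?_
  rw [Finset.sum_mul]
  refine Finset.sum_le_sum fun l hl => ?_
  refine (mul_le_mul (mul_le_mul_of_nonneg_left
    ((C.le_seminorms c hK l f hz).trans (hS l hl)) (Nat.cast_nonneg _))
    (D.le_seminorms c hK (k - l) η hz) (norm_nonneg _)
    (mul_nonneg (Nat.cast_nonneg _) hS0)).trans_eq ?_
  exact mul_right_comm _ _ _

theorem SmoothFun.continuous_mulDensityLinear (η : Density n M) :
    Continuous (SmoothFun.mulDensityLinear η) := by
  classical
  refine WithSeminorms.continuous_of_isBounded (τ₁₂ := RingHom.id ℂ)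
    (SmoothFun.coords n M).withSeminorms (Density.coords n M).withSeminorms
    (SmoothFun.mulDensityLinear η) fun i => ?_
  obtain ⟨c, ⟨K, hK⟩, k⟩ := i
  let g : ℕ → Σ j : SmoothChart n M, {K : Set (Model n) // IsCompact K ∧ K ⊆
    (SmoothFun.coords n M).dom j} × ℕ := fun l => ⟨c, ⟨K, hK⟩, l⟩
  obtain ⟨B, hB⟩ : ∃ B : NNReal, (B : ℝ) = ∑ l ∈ Finset.range (k + 1),
      (k.choose l : ℝ) * (Density.coords n M).seminorms ⟨c, ⟨K, hK⟩, k - l⟩ η :=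
    CanLift.prf _ (Finset.sum_nonneg fun _ _ => mul_nonneg (Nat.cast_nonneg _) (apply_nonneg _ _))
  refine ⟨(Finset.range (k + 1)).image g, B, fun f => ?_⟩
  refine (SmoothFun.seminorms_mulDensity_le η f c hK k fun l hl => Seminorm.le_def.1
    (Finset.le_sup (f := (SmoothFun.coords n M).seminorms) (Finset.mem_image_of_mem g hl))
    f).trans_eq ?_
  rw [← hB]
  rfl

/-- The pull-back of smooth functions as a continuous linear map. -/
noncomputable def SmoothFun.pullbackCLM [IsManifold (𝓡 n) ∞ M] (χ : M ≃ₘ^∞⟮𝓡 n, 𝓡 n⟯ M) :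
    SmoothFun n M →L[ℂ] SmoothFun n M where
  toFun := SmoothFun.pullback χ
  map_add' _ _ := rfl
  map_smul' _ _ := rfl
  cont := by
    let A : SmoothFun n M →ₗ[ℂ] SmoothFun n M :=
      { toFun := SmoothFun.pullback χ
        map_add' := fun _ _ => rfl
        map_smul' := fun _ _ => rfl }
    -- In the chart `c`, `χ^* f` is literally `f` in the chart `c ∘ χ⁻¹`; the two seminorms are
    -- equal, with the same `K` and `k`.
    refine WithSeminorms.continuous_of_isBounded (τ₁₂ := RingHom.id ℂ)
      (SmoothFun.coords n M).withSeminorms (SmoothFun.coords n M).withSeminorms A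
      fun ⟨c, ⟨K, hK⟩, k⟩ => ⟨{⟨transportChart χ c, ⟨K, hK⟩, k⟩}, 1, fun f => ?_⟩
    rw [Finset.sup_singleton, one_smul]
    rfl

/-- The push-forward of smoothing operators as a continuous linear map. -/
noncomputable def SmoothingOp.pushforwardCLM [IsManifold (𝓡 n) ∞ M] (χ : M ≃ₘ^∞⟮𝓡 n, 𝓡 n⟯ M) :
    SmoothingOp n M →L[ℂ] SmoothingOp n M where
  toFun := SmoothingOp.pushforward χ
  map_add' _ _ := rfl
  map_smul' _ _ := rfl
  cont := by
    let A : SmoothingOp n M →ₗ[ℂ] SmoothingOp n M :=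
      { toFun := SmoothingOp.pushforward χ
        map_add' := fun _ _ => rfl
        map_smul' := fun _ _ => rfl }
    set C := SmoothingOp.coords n M
    refine WithSeminorms.continuous_of_isBounded (τ₁₂ := RingHom.id ℂ)
      C.withSeminorms C.withSeminorms A
      fun ⟨c, ⟨K, hK⟩, k⟩ =>
        ⟨{⟨(transportChart χ.symm c.1, transportChart χ.symm c.2), ⟨K, hK⟩, k⟩}, 1, fun T => ?_⟩
    rw [Finset.sup_singleton, one_smul]
    refine C.seminorms_le c hK k _ (apply_nonneg _ _) fun p hp => ?_
    refine le_of_eq_of_le ?_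
      (C.le_seminorms (transportChart χ.symm c.1, transportChart χ.symm c.2) hK k T hp)
    -- The coefficients agree only over the chart domains, where the chain rule for `mfderiv`
    -- applies; equality of germs at `p` is enough for the derivatives.
    have heq : C.rep c (A T) =ᶠ[𝓝 p]
        C.rep (transportChart χ.symm c.1, transportChart χ.symm c.2) T := by
      filter_upwards [(C.isOpen_dom c).mem_nhds (hK.2 hp)] with q hq
      exact coeff_prePullback χ.symm c.2 _ hq.2
    exact congrArg norm (heq.iteratedFDeriv ℝ k).eq_of_nhds

/-- The action `T ↦ T u` on a fixed distribution as a continuous linear map. -/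
noncomputable def SmoothingOp.applyCLM [IsManifold (𝓡 n) ∞ M] (u : DistributionOn n M) :
    SmoothingOp n M →L[ℂ] SmoothFun n M where
  toFun T := T.apply u
  map_add' T S := Subtype.ext <| funext fun x => map_add u (T.row x) (S.row x)
  map_smul' a T := Subtype.ext <| funext fun x => map_smul u a (T.row x)
  cont := by
    let A : SmoothingOp n M →ₗ[ℂ] SmoothFun n M :=
      { toFun := fun T => T.apply u
        map_add' := fun T S => Subtype.ext <| funext fun x => map_add u (T.row x) (S.row x)
        map_smul' := fun a T => Subtype.ext <| funext fun x => map_smul u a (T.row x) }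
    set C := SmoothingOp.coords n M
    set D := SmoothFun.coords n M
    classical
    refine WithSeminorms.continuous_of_isBounded (τ₁₂ := RingHom.id ℂ)
      C.withSeminorms D.withSeminorms A fun ⟨c, ⟨K, hK⟩, k⟩ => ?_
    -- The parameter is the coordinate of `x` in the chart `c`, and the family is the rows `k_T(x,
    -- ·)`. Neither `s` nor `B` depends on `T`.
    obtain ⟨s, B, hB, h⟩ := (Density.coords n M).exists_norm_iteratedFDeriv_apply_le
      u.toLinearMap u.continuous c.1.open_target k
    -- Each density seminorm bounding `u` becomes a kernel seminorm: `x` ranges over `K`, `y` over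
    -- the compact set of `i`, and the `k` derivatives in `x` are added to the order in `y`.
    let g : (Σ j : SmoothChart n M, {K : Set (Model n) // IsCompact K ∧ K ⊆
        (Density.coords n M).dom j} × ℕ) →
        Σ j : SmoothChart n M × SmoothChart n M, {K : Set (Model n × Model n) // IsCompact K ∧ K ⊆
          C.dom j} × ℕ := fun i =>
      ⟨(c, i.1), ⟨K ×ˢ i.2.1.1, hK.1.prod i.2.1.2.1, prod_mono hK.2 i.2.1.2.2⟩, k + i.2.2⟩
    refine ⟨s.image g, ⟨B, hB⟩, fun T => ?_⟩
    refine D.seminorms_le c hK k _ (apply_nonneg _ _) fun z hz => ?_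
    refine h (fun z => T.row (c.1.symm z)) (fun c' => T.2.2 c c') z (hK.2 hz)
      (((s.image g).sup C.seminorms) T) (apply_nonneg _ _) fun i hi w hw => ?_
    exact (C.le_seminorms (c, i.1) (g i).2.1.2 (k + i.2.2) T (z := (z, w)) ⟨hz, hw⟩).trans
      (Seminorm.le_def.1 (Finset.le_sup (f := C.seminorms) (Finset.mem_image_of_mem g hi)) T)

/-- The smoothing operator with kernel `k(x, y) = η(y)`. -/
noncomputable def Density.constKernel (η : Density n M) : SmoothingOp n M :=
  ⟨fun _ => η.1, fun _ => η.2.1, fun _ c' => (η.2.2 c').comp contDiffOn_snd fun _ hp => hp.2⟩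

variable [IsManifold (𝓡 n) ∞ M]

theorem evalMap_mem_smoothMaps (u : DistributionOn n M) : evalMap n M u ∈ smoothMaps n M :=
  fun _ => FrechetContDiffOn.clm ((SmoothingOp.applyCLM u).restrictScalars ℝ) _

/-- On the kernel `k(x, y) = η(y)`, the function `T u` has the constant value `⟨u, η⟩`. Reading it
off needs a point of `M`; if `M` is empty, all densities vanish. -/
theorem evalMap_injective : Function.Injective (evalMap n M) := by
  intro u v huv
  ext η
  rcases isEmpty_or_nonempty M with hM | ⟨⟨x⟩⟩
  · have : η = 0 := Subtype.ext <| funext fun y => hM.elim y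
    rw [this, map_zero, map_zero]
  · exact congrArg (fun f : SmoothFun n M => f x) (congrFun huv η.constKernel)

theorem pullbackMap_mem_smoothMaps (χ : M ≃ₘ^∞⟮𝓡 n, 𝓡 n⟯ M)
    {φ : SmoothingOp n M → SmoothFun n M} (hφ : φ ∈ smoothMaps n M) :
    pullbackMap χ φ ∈ smoothMaps n M := fun m =>
  ((hφ m).comp_linear ((SmoothingOp.pushforwardCLM χ).restrictScalars ℝ)
    (mapsTo_univ _ _)).clm_comp ((SmoothFun.pullbackCLM χ).restrictScalars ℝ)

theorem pullbackMap_evalMap (χ : M ≃ₘ^∞⟮𝓡 n, 𝓡 n⟯ M) (u : DistributionOn n M) :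
    pullbackMap χ (evalMap n M u) = evalMap n M (pullbackDistribution χ u) := by
  funext T
  refine Subtype.ext <| funext fun x => ?_
  -- `(χ_* T) u = (χ⁻¹)^* (T (χ^* u))` holds by definition, so only the cancellation of `χ⁻¹ ∘ χ` is
  -- left.
  change (T.apply (pullbackDistribution χ u)).1 (χ.symm (χ x)) = _
  rw [χ.symm_apply_apply]
  rfl

end Continuity

/-! ### The embedding into the quotient algebra. -/

section Embedding

variable {n : ℕ} {M : Type*} [TopologicalSpace M] [ChartedSpace (Model n) M]
  [IsManifold (𝓡 n) ∞ M] [CompactSpace M] [T2Space M]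

/-- Writing `∫ f η` as the distribution `1` paired with `f η` moves the dependence on `f` into the
density. No further estimate of the integral is needed. -/
theorem SmoothFun.continuous_toDistribution_apply (η : Density n M) :
    Continuous fun f : SmoothFun n M => f.toDistribution η := by
  have h1 : ∀ ξ : Density n M, (1 : SmoothFun n M).mulDensity ξ = ξ := fun ξ =>
    Subtype.ext <| funext fun y => funext fun v => one_mul _
  have h : (fun f : SmoothFun n M => f.toDistribution η) =
      fun f : SmoothFun n M => (1 : SmoothFun n M).toDistribution (f.mulDensity η) :=
    funext fun f => congrArg Density.integral (h1 (f.mulDensity η)).symm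
  rw [h]
  exact (1 : SmoothFun n M).toDistribution.continuous.comp (SmoothFun.continuous_mulDensityLinear η)

theorem SmoothFun.toDistribution_zero : (0 : SmoothFun n M).toDistribution = 0 := by
  ext η
  have h : (0 : SmoothFun n M).mulDensity η = (0 : SmoothFun n M).mulDensity 0 :=
    Subtype.ext <| funext fun y => funext fun v => (zero_mul _).trans (zero_mul _).symm
  calc (0 : SmoothFun n M).toDistribution η = (0 : SmoothFun n M).toDistribution 0 :=
        congrArg Density.integral h
    _ = 0 := map_zero _

theorem evalMap_mem_moderateMaps {𝓛 : Set (ℝ → SmoothingOp n M)}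
    (h𝓛 : 𝓛 ⊆ moderateApproximateUnits n M) (u : DistributionOn n M) :
    evalMap n M u ∈ moderateMaps 𝓛 :=
  ⟨evalMap_mem_smoothMaps u, fun _ hT => (h𝓛 hT).1.clm_comp (SmoothingOp.applyCLM u)⟩

/-- The map `u ↦ [Θ_u]` from distributions to generalized functions. -/
noncomputable def distributionEmbedding {𝓛 : Set (ℝ → SmoothingOp n M)}
    (h𝓛 : 𝓛 ⊆ moderateApproximateUnits n M) : DistributionOn n M →ₗ[ℂ] GeneralizedFun 𝓛 :=
  (Ideal.Quotient.mkₐ ℂ (negligibleMaps 𝓛)).toLinearMap.comp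
    ((evalMap n M).codRestrict (Subalgebra.toSubmodule (moderateMaps 𝓛))
      (evalMap_mem_moderateMaps h𝓛))

/-- Paired with any density, `T_ε u` tends both to `⟨u, η⟩`, by the approximate unit property, and
to `0`, by negligibility. -/
theorem distributionEmbedding_injective {𝓛 : Set (ℝ → SmoothingOp n M)}
    (h𝓛 : 𝓛 ⊆ moderateApproximateUnits n M) (hne : 𝓛.Nonempty) :
    Function.Injective (distributionEmbedding h𝓛) := by
  refine (injective_iff_map_eq_zero _).2 fun u hu => ?_
  obtain ⟨T, hT⟩ := hne
  have hN : IsNegligibleNet fun ε => (T ε).apply u :=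
    (Ideal.Quotient.eq_zero_iff_mem.1 hu : _ ∈ negligibleMaps 𝓛) T hT
  ext η
  have h0 := ((SmoothFun.continuous_toDistribution_apply η).tendsto 0).comp hN.tendsto_zero
  rw [SmoothFun.toDistribution_zero] at h0
  exact tendsto_nhds_unique ((h𝓛 hT).2.1 u η) h0

/-- Smooth functions as constant maps on the space of smoothing operators. -/
noncomputable def constMaps (𝓛 : Set (ℝ → SmoothingOp n M)) :
    SmoothFun n M →ₐ[ℂ] moderateMaps 𝓛 :=
  (Pi.constAlgHom ℂ (SmoothingOp n M) (SmoothFun n M)).codRestrict (moderateMaps 𝓛) fun f =>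
    ⟨fun _ => FrechetContDiffOn.const f _, fun _ _ => IsModerateNet.const f⟩

/-- This is the super-polynomial convergence `T_ε f → f`. It transfers the algebra structure from
constant maps, where it is evident, to the classes `[Θ_f]`. -/
theorem mk_constMaps {𝓛 : Set (ℝ → SmoothingOp n M)} (h𝓛 : 𝓛 ⊆ moderateApproximateUnits n M)
    (f : SmoothFun n M) : Ideal.Quotient.mkₐ ℂ (negligibleMaps 𝓛) (constMaps 𝓛 f) =
      distributionEmbedding h𝓛 f.toDistribution := by
  refine (Ideal.Quotient.eq.2 fun T hT => ?_ : Ideal.Quotient.mk (negligibleMaps 𝓛) (constMaps 𝓛 f)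
    = Ideal.Quotient.mk (negligibleMaps 𝓛)
      ⟨evalMap n M f.toDistribution, evalMap_mem_moderateMaps h𝓛 _⟩)
  -- Negligibility includes smoothness of the net in `ε`; the difference already has it as an
  -- element of the subalgebra of moderate maps.
  have hm : (constMaps 𝓛 f - ⟨evalMap n M f.toDistribution, evalMap_mem_moderateMaps h𝓛 _⟩ :
    moderateMaps 𝓛).1 ∈ moderateMaps 𝓛 := Subtype.property _
  refine ⟨(hm.2 T hT).1, fun ρ hρ N => ?_⟩
  refine ((h𝓛 hT).2.2 f ρ hρ N).congr_left fun ε => ?_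
  exact map_sub_rev ρ _ _

end Embedding

end GenFun

theorem mainTheorem1 {n : ℕ} {M : Type*} [TopologicalSpace M]
    [ChartedSpace (EuclideanSpace ℝ (Fin n)) M] [IsManifold (𝓡 n) ∞ M] [CompactSpace M]
    [T2Space M] :
    -- evaluation maps of distributions are moderate over all moderate approximate units
    (∀ u : DistributionOn n M, evalMap n M u ∈ moderateMaps (moderateApproximateUnits n M)) ∧
    (∀ 𝓛 : Set (ℝ → SmoothingOp n M), 𝓛 ⊆ moderateApproximateUnits n M →
      (∀ u : DistributionOn n M, evalMap n M u ∈ moderateMaps 𝓛) ∧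
      -- the embedding into the algebra of generalized functions over `𝓛`
      ∃ ι : DistributionOn n M →ₗ[ℂ] GeneralizedFun 𝓛,
        (∀ (u : DistributionOn n M) (hu : evalMap n M u ∈ moderateMaps 𝓛),
          ι u = Ideal.Quotient.mk (negligibleMaps 𝓛) ⟨evalMap n M u, hu⟩) ∧
        (𝓛.Nonempty → Function.Injective ι) ∧
        ∃ σ : SmoothFun n M →ₐ[ℂ] GeneralizedFun 𝓛, ∀ f, σ f = ι f.toDistribution) ∧
    -- the equivariant embedding into the smooth maps
    (∀ u : DistributionOn n M, evalMap n M u ∈ smoothMaps n M) ∧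
    Function.Injective (evalMap n M) ∧
    (∀ χ : M ≃ₘ^∞⟮𝓡 n, 𝓡 n⟯ M,
      (∀ φ ∈ smoothMaps n M, pullbackMap χ φ ∈ smoothMaps n M) ∧
      ∀ u : DistributionOn n M,
        pullbackMap χ (evalMap n M u) = evalMap n M (pullbackDistribution χ u)) := by
  refine ⟨evalMap_mem_moderateMaps subset_rfl, fun 𝓛 h𝓛 => ⟨evalMap_mem_moderateMaps h𝓛,
    distributionEmbedding h𝓛, fun _ _ => rfl, distributionEmbedding_injective h𝓛,
    -- As a composite of algebra homomorphisms, this witness is multiplicative and unital by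
    -- construction.
    (Ideal.Quotient.mkₐ ℂ (negligibleMaps 𝓛)).comp (constMaps 𝓛), mk_constMaps h𝓛⟩,
    evalMap_mem_smoothMaps, evalMap_injective, fun χ =>
      ⟨fun _ hφ => pullbackMap_mem_smoothMaps χ hφ, pullbackMap_evalMap χ⟩⟩
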